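/- **Spin systems.** A spin system $S$ of spin type $q\ge 2$ consists of a finite set $V_S$ of spins, a set $E_S$ of subsets of $V_S$ (hyperedges) such that every spin lies in some hyperedge, and a function $J_S(e)\colon[q]^e\to\mathbb R_{\ge0}$ for every $e\in E_S$. Put $\mathcal C_S=[q]^{V_S}$, $H_S(\vec s)=\sum_{e\in E_S}J_S(e)(\vec s|_e)$, $|S|=\sum_{e\in E_S}q^{|e|}$ and $Z_S(\beta)=\sum_{\vec s\in\mathcal C_S}e^{-\beta H_S(\vec s)}$. A spin model $\mathcal M$ is a set of spin systems of the same spin type $q_{\mathcal M}$ that is closed under isomorphism (relabelling of spins). **Simulations.** A simulation $f\colon S\to T$ consists of a cut-off $\Delta\ge0$, a shift $\Gamma\in\mathbb R$, a degeneracy $d\ge1$, a map $P\colon V_T\to V_S^k$, a decoding $\mathrm{dec}\colon[q_S]^k\to[q_T]$ and encodings $\mathrm{enc}_1,\dots,\mathrm{enc}_m\colon[q_T]\to[q_S]^k$ with $m\ge1$, such that (1) $P^{(i)}(v)=P^{(j)}(w)$ implies $i=j$ and $v=w$; (2) $\mathrm{dec}\circ\mathrm{enc}_i=\mathrm{id}$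 for all $i$; (3) $\mathrm{enc}_i(t)=\mathrm{enc}_j(t)$ for some $t$ implies $i=j$; (4) with $\mathrm{sim}_i(\vec t)=\{\vec s\in\mathcal C_S:\vec s\circ P=\mathrm{enc}_i\circ\vec t,\ H_S(\vec s)-\Gamma<\Delta\}$, one has $|\mathrm{sim}_i(\vec t)|=d$ for all $i$ whenever $H_T(\vec t)<\Delta$; (5) $H_S(\vec s)-\Gamma=H_T(\vec t)$ for all $\vec s\in\bigcup_i\mathrm{sim}_i(\vec t)$, and $H_S(\vec s)-\Gamma\ge\Delta$ for all $\vec s\notin\bigcup_{\vec t,i}\mathrm{sim}_i(\vec t)$. **Computation.** Algorithms are programs of a real random access machine with unit-cost addition, subtraction, multiplication, division, exponential, logarithm, real constants and comparisons of reals, and with arrays of reals that are addressed through natural-number registers. Spin systems (with spins labelled by natural numbers) and simulations are presented as lists of reals that contain all their data, every function being given by its function graph. Polynomial time refers to the number of real parameters of the input, equivalently to the size $|T|$ of the spin system $T$ in the input. **Emulations.** An emulation $\mathrm{Emu}\colon\mathcal M\to\mathcal M'$ is an algorithm that, given $T\in\mathcal M'$ and $\delta\ge0$, computes in time $\mathrm{poly}(|T|)$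 a spin system $S(T,\delta)\in\mathcal M$ and a simulation $f(T,\delta)\colon S(T,\delta)\to T$ with cut-off $\delta$, such that the hypergraph $(V_{S(T,\delta)},E_{S(T,\delta)})$ and all data of $f(T,\delta)$ except for cut-off and shift are independent of $\delta$, and such that $\mathrm{dec}$ and $(\mathrm{enc}_i)_i$ are the same for all $T\in\mathcal M'$ and all $\delta$. **PTAS reductions.** $\mathrm{Part}_{\mathcal M}$ is the problem of computing $Z_S(\beta)$, given $S\in\mathcal M$ and $\beta>0$. A PTAS reduction $\mathrm{Part}_{\mathcal M'}\to\mathrm{Part}_{\mathcal M}$ is a triple of polynomial-time computable functions $f\colon(\mathcal M'\times\mathbb R_{>0})\times\mathbb R_{>0}\to\mathcal M\times\mathbb R_{>0}$, $g\colon(\mathcal M'\times\mathbb R_{>0})\times\mathbb R\times\mathbb R_{>0}\to\mathbb R$, $\alpha\colon\mathbb R_{>0}\to\mathbb R_{>0}$ such that for all $T\in\mathcal M'$, $\beta,\epsilon>0$ and $z\in\mathbb R$, writing $f(T,\beta,\epsilon)=(S,\beta')$, $$|z-Z_S(\beta')|<\alpha(\epsilon)\,Z_S(\beta')\ \Longrightarrow\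 |g(T,\beta,z,\epsilon)-Z_T(\beta)|<\epsilon\,Z_T(\beta).$$ **Theorem.** Let $\mathcal M,\mathcal M'$ be spin models. Every emulation $\mathrm{Emu}\colon\mathcal M\to\mathcal M'$ induces a PTAS reduction $(f,g,\alpha)\colon\mathrm{Part}_{\mathcal M'}\to\mathrm{Part}_{\mathcal M}$. More precisely, there are such a reduction and cut-offs $\delta=\delta(T,\beta,\epsilon)\ge0$ such that $\alpha(\epsilon)=\epsilon/2$ and, for all $T\in\mathcal M'$ and $\beta,\epsilon>0$, with $S=S(T,\delta)$ and with $\Gamma,d,m$ the shift, degeneracy and number of encodings of $f(T,\delta)$: - $f(T,\beta,\epsilon)=(S,\beta)$; - $\delta>\max H_T$, and the exponentially small error term is, relative to $Z_T(\beta)$, below $\epsilon/2$: $$\Bigl(1+\frac\epsilon2\Bigr)\frac{q_{\mathcal M}^{|V_S|}}{m\,d}\,e^{-\beta\delta}<\frac\epsilon2\,Z_T(\beta);$$ - if $V_T\neq\emptyset$, then $g(T,\beta,z,\epsilon)=\dfrac{z}{e^{-\beta\Gamma}\,m\,d}$ for all $z\in\mathbb R$. -/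

import Mathlib

open scoped NNReal

namespace SpinEmulation

/-! ## Spin systems and spin models -/

/-- An interaction hypergraph: a finite set `V` of spins (labelled by natural numbers), a set `E`
of hyperedges `e ⊆ V`, and no isolated spins. -/
structure InteractionGraph where
  V : Finset ℕ
  E : Finset (Finset V)
  no_isolated : ∀ v : V, ∃ e ∈ E, v ∈ e

/-- A spin system of spin type `q ≥ 2`: an interaction hypergraph with a local interaction
`J e : [q]^e → ℝ≥0` for every hyperedge `e`. The `q` spin states are the elements of `Fin q`. -/
structure SpinSystem (q : ℕ) where
  two_le : 2 ≤ q
  graph : InteractionGraph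
  J : (e : graph.E) → (e.1 → Fin q) → ℝ≥0

namespace SpinSystem

variable {q : ℕ}

/-- Spin configurations of `S`. -/
abbrev Config (S : SpinSystem q) : Type := S.graph.V → Fin q

/-- The Hamiltonian: the sum of the local energies. -/
def hamiltonian (S : SpinSystem q) (s : S.Config) : ℝ :=
  ∑ e : S.graph.E, (S.J e (fun v => s v.1) : ℝ)

/-- The size of `S`: the number of energy values that specify it. -/
def size (S : SpinSystem q) : ℕ := ∑ e ∈ S.graph.E, q ^ e.card

/-- The partition function. -/
noncomputable def partitionFunction (S : SpinSystem q) (β : ℝ) : ℝ :=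
  ∑ s : S.Config, Real.exp (-β * S.hamiltonian s)

/-- Isomorphism of spin systems: a bijection `φ` of the spins that maps hyperedges to hyperedges
(in both directions) and local interactions to local interactions,
`J_S(e)(s ∘ φ) = J_T(φ(e))(s)`. -/
def Isomorphic (S T : SpinSystem q) : Prop :=
  ∃ φ : S.graph.V ≃ T.graph.V,
    ∃ hE : ∀ e : Finset S.graph.V, e ∈ S.graph.E ↔ e.map φ.toEmbedding ∈ T.graph.E,
      ∀ (e : Finset S.graph.V) (he : e ∈ S.graph.E) (s : (e.map φ.toEmbedding) → Fin q),
        S.J ⟨e, he⟩ (fun v => s ⟨φ v.1, Finset.mem_map_of_mem _ v.2⟩) =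
          T.J ⟨e.map φ.toEmbedding, (hE e).1 he⟩ s

end SpinSystem

/-- A spin model: a set of spin systems of constant spin type `q`, closed under isomorphism. -/
structure SpinModel (q : ℕ) where
  systems : Set (SpinSystem q)
  closed_iso : ∀ S ∈ systems, ∀ S' : SpinSystem q, S'.Isomorphic S → S' ∈ systems

/-! ## Simulations -/

/-- A decoding `[q]^k → [q']` and a list of `m` encodings `[q'] → [q]^k`. -/
structure Coding (q q' : ℕ) where
  order : ℕ
  number : ℕ
  dec : (Fin order → Fin q) → Fin q'
  enc : Fin number → Fin q' → Fin order → Fin q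

/-- The data of a simulation other than cut-off and energy shift: decoding and encodings,
degeneracy and physical spin assignment (`V'` are the spins of the target). -/
structure SimData (q q' : ℕ) (V' : Finset ℕ) where
  coding : Coding q q'
  degeneracy : ℕ
  phys : V' → Fin coding.order → ℕ

/-- A simulation of type `S → T`. -/
structure Simulation {q q' : ℕ} (S : SpinSystem q) (T : SpinSystem q') where
  cutoff : ℝ
  shift : ℝ
  data : SimData q q' T.graph.V
  cutoff_nonneg : 0 ≤ cutoff
  degeneracy_pos : 0 < data.degeneracy
  number_pos : 0 < data.coding.number
  phys_mem : ∀ v i, data.phys v i ∈ S.graph.V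
  /-- Disjoint physical spins. -/
  phys_disjoint : ∀ v w i j, data.phys v i = data.phys w j → i = j ∧ v = w
  /-- Decode-encode compatibility. -/
  dec_enc : ∀ i t, data.coding.dec (data.coding.enc i t) = t
  /-- Disjoint encodings. -/
  enc_disjoint : ∀ i j t, data.coding.enc i t = data.coding.enc j t → i = j
  /-- Constant local degeneracy: if `H_T(t) < Δ` then `|sim_i(t)| = d`, where `sim_i(t)` is the set
  of the source configurations `s` with `s ∘ P = enc_i ∘ t` and `H_S(s) - Γ < Δ`. -/
  local_degeneracy : ∀ i (t : T.Config), T.hamiltonian t < cutoff →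
    {s : S.Config | (∀ v j, s ⟨data.phys v j, phys_mem v j⟩ = data.coding.enc i (t v) j) ∧
      S.hamiltonian s - shift < cutoff}.ncard = data.degeneracy
  /-- Matching energies on `sim(t) = ⋃ i, sim_i(t)`. -/
  energy_low : ∀ i (t : T.Config) (s : S.Config),
    (∀ v j, s ⟨data.phys v j, phys_mem v j⟩ = data.coding.enc i (t v) j) →
    S.hamiltonian s - shift < cutoff → S.hamiltonian s - shift = T.hamiltonian t
  /-- High energies outside of `⋃ t, sim(t)`. -/
  energy_high : ∀ s : S.Config,
    (¬ ∃ (i : Fin data.coding.number) (t : T.Config),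
      (∀ v j, s ⟨data.phys v j, phys_mem v j⟩ = data.coding.enc i (t v) j) ∧
      S.hamiltonian s - shift < cutoff) →
    cutoff ≤ S.hamiltonian s - shift

/-! ## Real random access machines

Structured programs for a real RAM. The memory consists of real registers, index registers that
hold natural numbers, and arrays of reals that are addressed through index registers. Index
registers can only be reset, copied, incremented and decremented. Every instruction and every test
takes one unit of time; the real instructions are constants, the four arithmetic operations,
exponential and logarithm. -/

/-- Memory contents of the machine. -/
structure Memory where
  reg : ℕ → ℝ
  idx : ℕ → ℕ
  arr : ℕ → ℕ → ℝ

/-- Elementary instructions. -/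
inductive Instr where
  /-- `reg i := c` -/
  | const (i : ℕ) (c : ℝ)
  /-- `reg i := reg j + reg k` -/
  | add (i j k : ℕ)
  /-- `reg i := reg j - reg k` -/
  | sub (i j k : ℕ)
  /-- `reg i := reg j * reg k` -/
  | mul (i j k : ℕ)
  /-- `reg i := reg j / reg k` -/
  | div (i j k : ℕ)
  /-- `reg i := exp (reg j)` -/
  | exp (i j : ℕ)
  /-- `reg i := log (reg j)` -/
  | log (i j : ℕ)
  /-- `reg i := arr a [idx n]` -/
  | load (i a n : ℕ)
  /-- `arr a [idx n] := reg i` -/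
  | store (a n i : ℕ)
  /-- `reg i := idx n` -/
  | ofIdx (i n : ℕ)
  /-- `idx n := 0` -/
  | idxZero (n : ℕ)
  /-- `idx n := idx m` -/
  | idxCopy (n m : ℕ)
  /-- `idx n := idx n + 1` -/
  | idxSucc (n : ℕ)
  /-- `idx n := idx n - 1` (and `0` stays `0`) -/
  | idxPred (n : ℕ)

/-- The effect of an elementary instruction. -/
noncomputable def Instr.apply : Instr → Memory → Memory
  | .const i c, μ => { μ with reg := Function.update μ.reg i c }
  | .add i j k, μ => { μ with reg := Function.update μ.reg i (μ.reg j + μ.reg k) }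
  | .sub i j k, μ => { μ with reg := Function.update μ.reg i (μ.reg j - μ.reg k) }
  | .mul i j k, μ => { μ with reg := Function.update μ.reg i (μ.reg j * μ.reg k) }
  | .div i j k, μ => { μ with reg := Function.update μ.reg i (μ.reg j / μ.reg k) }
  | .exp i j, μ => { μ with reg := Function.update μ.reg i (Real.exp (μ.reg j)) }
  | .log i j, μ => { μ with reg := Function.update μ.reg i (Real.log (μ.reg j)) }
  | .load i a n, μ => { μ with reg := Function.update μ.reg i (μ.arr a (μ.idx n)) }
  | .store a n i, μ =>
      { μ with arr := Function.update μ.arr a (Function.update (μ.arr a) (μ.idx n) (μ.reg i)) }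
  | .ofIdx i n, μ => { μ with reg := Function.update μ.reg i (μ.idx n : ℝ) }
  | .idxZero n, μ => { μ with idx := Function.update μ.idx n 0 }
  | .idxCopy n m, μ => { μ with idx := Function.update μ.idx n (μ.idx m) }
  | .idxSucc n, μ => { μ with idx := Function.update μ.idx n (μ.idx n + 1) }
  | .idxPred n, μ => { μ with idx := Function.update μ.idx n (μ.idx n - 1) }

/-- Tests: comparison of two real registers, or of two index registers. -/
inductive Test where
  | regLt (i j : ℕ)
  | idxLt (n m : ℕ)

/-- The outcome of a test. -/
def Test.Holds : Test → Memory → Prop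
  | .regLt i j, μ => μ.reg i < μ.reg j
  | .idxLt n m, μ => μ.idx n < μ.idx m

/-- Programs. -/
inductive Program where
  | instr (i : Instr)
  | seq (P Q : Program)
  | ite (c : Test) (P Q : Program)
  | loop (c : Test) (P : Program)

/-- `P.Runs μ t μ'`: started in memory `μ`, program `P` halts after exactly `t` steps in memory
`μ'`. The program `loop c P` repeats `P` as long as `c` holds. -/
inductive Program.Runs : Program → Memory → ℕ → Memory → Prop where
  | instr (i : Instr) (μ : Memory) : Runs (.instr i) μ 1 (i.apply μ)
  | seq {P Q : Program} {μ μ' μ'' : Memory} {t t' : ℕ} :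
      Runs P μ t μ' → Runs Q μ' t' μ'' → Runs (.seq P Q) μ (t + t') μ''
  | ite_pos {c : Test} {P Q : Program} {μ μ' : Memory} {t : ℕ} :
      c.Holds μ → Runs P μ t μ' → Runs (.ite c P Q) μ (t + 1) μ'
  | ite_neg {c : Test} {P Q : Program} {μ μ' : Memory} {t : ℕ} :
      ¬ c.Holds μ → Runs Q μ t μ' → Runs (.ite c P Q) μ (t + 1) μ'
  | loop_done {c : Test} {P : Program} {μ : Memory} :
      ¬ c.Holds μ → Runs (.loop c P) μ 1 μ
  | loop_step {c : Test} {P : Program} {μ μ' μ'' : Memory} {t t' : ℕ} :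
      c.Holds μ → Runs P μ t μ' → Runs (.loop c P) μ' t' μ'' →
      Runs (.loop c P) μ (t + t' + 1) μ''

/-- Initial memory on input `l`: array `0` holds `l`, index register `0` holds its length, and
everything else is zero. -/
def Memory.init (l : List ℝ) : Memory where
  reg := fun _ => 0
  idx := fun n => if n = 0 then l.length else 0
  arr := fun a n => if a = 0 then l.getD n 0 else 0

/-- The output in memory `μ` is `l`: index register `0` holds the length of `l`, and the first cells
of array `0` hold its entries. -/
def Memory.Outputs (μ : Memory) (l : List ℝ) : Prop :=
  μ.idx 0 = l.length ∧ ∀ (n : ℕ) (h : n < l.length), μ.arr 0 n = l[n]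

/-- On input `l`, program `P` halts within `t` steps with output `l'`. -/
def Program.ComputesWithin (P : Program) (l : List ℝ) (t : ℕ) (l' : List ℝ) : Prop :=
  ∃ (t' : ℕ) (μ : Memory), t' ≤ t ∧ P.Runs (Memory.init l) t' μ ∧ μ.Outputs l'

/-- Program `P` solves the following task in polynomial time: given any presentation (according to
`inp`) of `x : X` as a list of reals, output a list of reals that meets the specification `out x`,
within a number of steps that is polynomial in `size x`. -/
def Program.PolytimeComputes {X : Type} (P : Program) (size : X → ℕ)
    (inp out : X → List ℝ → Prop) : Prop :=
  ∃ p : Polynomial ℕ, ∀ (x : X) (l : List ℝ), inp x l →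
    ∃ l' : List ℝ, out x l' ∧ P.ComputesWithin l (p.eval (size x)) l'

/-! ## Presentations as lists of reals -/

/-- A list of all elements of `α`, each once, in an arbitrary order. -/
def IsListing {α : Type} (L : List α) : Prop := L.Nodup ∧ ∀ a, a ∈ L

/-- The real `1, …, q` that stands for a spin state. -/
def stateReal {q : ℕ} (x : Fin q) : ℝ := ((x : ℕ) : ℝ) + 1

/-- `l` presents the spin system `S`: it consists of `q`, the list of spins, and the list of
hyperedges, where each hyperedge `e` comes with the list of its spins and with the function graph
of `J e`. Lists are preceded by their lengths. -/
def PresentsSystem {q : ℕ} (S : SpinSystem q) (l : List ℝ) : Prop :=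
  ∃ (LV : List S.graph.V) (LE : List S.graph.E) (Le : (e : S.graph.E) → List e.1)
    (Lc : (e : S.graph.E) → List (e.1 → Fin q)),
    IsListing LV ∧ IsListing LE ∧ (∀ e, IsListing (Le e)) ∧ (∀ e, IsListing (Lc e)) ∧
    l = [(q : ℝ), (LV.length : ℝ)] ++ LV.map (fun v : S.graph.V => ((v : ℕ) : ℝ)) ++
      [(LE.length : ℝ)] ++ LE.flatMap (fun e : S.graph.E =>
        [((Le e).length : ℝ)] ++ (Le e).map (fun v : e.1 => ((v.1 : ℕ) : ℝ)) ++
        [((Lc e).length : ℝ)] ++ (Lc e).flatMap (fun s =>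
          (Le e).map (fun v : e.1 => stateReal (s v)) ++ [(S.J e s : ℝ)]))

/-- `l` presents the simulation `f`: it consists of cut-off, shift, degeneracy, the order `k` and
the number `m` of the encodings, and the function graphs of the physical spin assignment, of the
decoding and of the `m` encodings. -/
def PresentsSimulation {q q' : ℕ} {S : SpinSystem q} {T : SpinSystem q'} (f : Simulation S T)
    (l : List ℝ) : Prop :=
  ∃ (LT : List T.graph.V) (Lx : List (Fin f.data.coding.order → Fin q)),
    IsListing LT ∧ IsListing Lx ∧
    l = [f.cutoff, f.shift, (f.data.degeneracy : ℝ), (f.data.coding.order : ℝ),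
        (f.data.coding.number : ℝ)] ++
      [(LT.length : ℝ)] ++ LT.flatMap (fun v : T.graph.V =>
        [((v : ℕ) : ℝ)] ++
          (List.finRange f.data.coding.order).map (fun j => (f.data.phys v j : ℝ))) ++
      [(Lx.length : ℝ)] ++ Lx.flatMap (fun x =>
        (List.finRange f.data.coding.order).map (fun j => stateReal (x j)) ++
          [stateReal (f.data.coding.dec x)]) ++
      (List.finRange f.data.coding.number).flatMap (fun i =>
        (List.finRange q').flatMap (fun t =>
          [stateReal t] ++
            (List.finRange f.data.coding.order).map
              (fun j => stateReal (f.data.coding.enc i t j))))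

/-! ## Emulations -/

/-- An emulation of type `M → M'`: a program that, on input `(T, δ)` with `T ∈ M'` and `δ ≥ 0`,
computes a spin system `source T δ ∈ M` and a simulation `sim T δ : source T δ → T`. -/
structure Emulation {q q' : ℕ} (M : SpinModel q) (M' : SpinModel q') where
  program : Program
  source : M'.systems → ℝ≥0 → SpinSystem q
  source_mem : ∀ T δ, source T δ ∈ M.systems
  sim : (T : M'.systems) → (δ : ℝ≥0) → Simulation (source T δ) T.1
  /-- The output simulation has cut-off `δ`. -/
  cutoff_eq : ∀ T δ, (sim T δ).cutoff = δ
  /-- Efficiency: the runtime is polynomial in the size of `T`. The output is presented by the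
  length of the presentation of the system, followed by the two presentations. -/
  efficient : program.PolytimeComputes (fun x : M'.systems × ℝ≥0 => x.1.1.size)
    (fun x l => ∃ l₀, PresentsSystem x.1.1 l₀ ∧ l = (x.2 : ℝ) :: l₀)
    (fun x l => ∃ l₁ l₂, PresentsSystem (source x.1 x.2) l₁ ∧ PresentsSimulation (sim x.1 x.2) l₂ ∧
      l = (l₁.length : ℝ) :: (l₁ ++ l₂))
  /-- Uniformity: the interaction hypergraph of the source and all data of the simulation except
  for cut-off and shift are independent of `δ`. -/
  graph_uniform : ∀ T δ₁ δ₂, (source T δ₁).graph = (source T δ₂).graph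
  sim_uniform : ∀ T δ₁ δ₂, (sim T δ₁).data = (sim T δ₂).data
  /-- Decoding and encodings only depend on the spin type of the target, which is constant. -/
  coding_const : ∀ T₁ δ₁ T₂ δ₂, (sim T₁ δ₁).data.coding = (sim T₂ δ₂).data.coding

/-! ## Approximation problems and PTAS reductions -/

/-- Positive reals. -/
abbrev PosReal : Type := {x : ℝ // 0 < x}

/-- A real-valued function problem: compute `value a` for a given instance `a`. -/
structure FunctionProblem where
  Inst : Type
  size : Inst → ℕ
  Presents : Inst → List ℝ → Prop
  value : Inst → ℝ

/-- `z` is an `ε`-approximation of the value `v`. -/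
def IsApprox (ε v z : ℝ) : Prop := |z - v| < ε * v

/-- The partition function problem of `M`: given `S ∈ M` and `β > 0`, compute `Z_S(β)`. -/
noncomputable abbrev partitionProblem {q : ℕ} (M : SpinModel q) : FunctionProblem where
  Inst := M.systems × PosReal
  size := fun a => a.1.1.size + 1
  Presents := fun a l => ∃ l₀, PresentsSystem a.1.1 l₀ ∧ l = (a.2 : ℝ) :: l₀
  value := fun a => a.1.1.partitionFunction a.2

/-- A PTAS reduction from `A` to `B`: polytime computable functions `f`, `g`, `α` such that `g`
turns every `α(ε)`-approximation for the instance `f(a, ε)` of `B` into an `ε`-approximation for the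
instance `a` of `A`. -/
structure PTASReduction (A B : FunctionProblem) where
  f : A.Inst → PosReal → B.Inst
  g : A.Inst → ℝ → PosReal → ℝ
  α : PosReal → PosReal
  f_polytime : ∃ P : Program, P.PolytimeComputes (fun x : A.Inst × PosReal => A.size x.1)
    (fun x l => ∃ l₀, A.Presents x.1 l₀ ∧ l = (x.2 : ℝ) :: l₀)
    (fun x l => B.Presents (f x.1 x.2) l)
  g_polytime : ∃ P : Program, P.PolytimeComputes (fun x : A.Inst × ℝ × PosReal => A.size x.1)
    (fun x l => ∃ l₀, A.Presents x.1 l₀ ∧ l = (x.2.2 : ℝ) :: x.2.1 :: l₀)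
    (fun x l => l = [g x.1 x.2.1 x.2.2])
  α_polytime : ∃ P : Program, P.PolytimeComputes (fun _ : PosReal => 1)
    (fun ε l => l = [(ε : ℝ)]) (fun ε l => l = [(α ε : ℝ)])
  correct : ∀ (a : A.Inst) (ε : PosReal) (z : ℝ),
    IsApprox (α ε) (B.value (f a ε)) z → IsApprox ε (A.value a) (g a z ε)

end SpinEmulation

/-!
An emulation yields a PTAS reduction because the partition function of a source system splits into
the contribution of the low energy configurations, which is exactly `e^{-βΓ} m d Z_T(β)`, and the
contribution of the others, which is at most `e^{-βΓ} q^{|V_S|} e^{-βδ}`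
(`Simulation.partitionFunction_approx`). If the cut-off `δ` is so large that
`(1 + ε/2) q^{|V_S|} e^{-βδ} < (ε/2) Z_T(β)`, then dividing an `ε/2`-approximation of `Z_S(β)` by
`e^{-βΓ} m d` gives an `ε`-approximation of `Z_T(β)` (`Simulation.isApprox_rescale`). If `T` has no
spins, the `m` encodings all describe the same set of low energy configurations, and the factor `m`
has to be left out (`Simulation.multiplicity`).

The cut-off must be computable from `(T, β, ε)`, and must not depend on the list of reals that
presents `T`. Let `W` be the sum of `x + 1` over all entries `x` of a presentation of `T`. It is the
same for all presentations (`PresentsSystem.sum_map`), it is at least the length of the presentation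
and at least every energy of `T`, and hence `Z_T(β) ≥ e^{-βW}`. Since `S` is written down by a
polynomial-time program, `|V_S| log q ≤ C e^W` for a constant `C` (`Emulation.exists_card_bound`).
So `δ = W + (C e^W + 1 + 2/ε) / β` is large enough (`error_lt`). The size of `δ` does not affect the
running time of the emulation.

The machine that computes the reduction sums up the presentation of `T` and overwrites its input
by `(T, δ)`, keeping its own data in registers that the program of the emulation does not mention.
That program then runs as it would on its own (`Program.Runs.frame`). Its output begins with the
length of the presentation of `S`, followed by that presentation: for the instance map, `β` replaces
the length and the rest is cut off, and for the value map, the length tells where `Γ`, `d` and `m`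
are found.
-/

namespace SpinEmulation

/-! ### Real random access machines: frames and straight-line code -/

/-- A number that is greater than the numbers of all registers and arrays that the instruction
mentions. Sums are used in place of maxima, as only the existence of a bound matters. -/
def Instr.bound : Instr → ℕ
  | .const i _ => i + 1
  | .add i j k => i + j + k + 1
  | .sub i j k => i + j + k + 1
  | .mul i j k => i + j + k + 1
  | .div i j k => i + j + k + 1
  | .exp i j => i + j + 1
  | .log i j => i + j + 1
  | .load i a n => i + a + n + 1
  | .store a n i => a + n + i + 1
  | .ofIdx i n => i + n + 1
  | .idxZero n => n + 1
  | .idxCopy n m => n + m + 1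
  | .idxSucc n => n + 1
  | .idxPred n => n + 1

/-- A number that is greater than the numbers of all registers that the test mentions. -/
def Test.bound : Test → ℕ
  | .regLt i j => i + j + 1
  | .idxLt n m => n + m + 1

/-- A number that is greater than the numbers of all registers and arrays that the program
mentions. -/
def Program.bound : Program → ℕ
  | .instr i => i.bound
  | .seq P Q => P.bound + Q.bound
  | .ite c P Q => c.bound + P.bound + Q.bound
  | .loop c P => c.bound + P.bound

/-- Two memories have the same contents in all registers and arrays whose number satisfies `p`. -/
def Memory.AgreeOn (p : ℕ → Prop) (μ ν : Memory) : Prop :=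
  ∀ n, p n → μ.reg n = ν.reg n ∧ μ.idx n = ν.idx n ∧ μ.arr n = ν.arr n

theorem Memory.AgreeOn.refl (p : ℕ → Prop) (μ : Memory) : μ.AgreeOn p μ :=
  fun _ _ => ⟨rfl, rfl, rfl⟩

theorem Memory.AgreeOn.trans {p : ℕ → Prop} {μ ν ρ : Memory} (h : μ.AgreeOn p ν)
    (h' : ν.AgreeOn p ρ) : μ.AgreeOn p ρ := fun n hn =>
  ⟨(h n hn).1.trans (h' n hn).1, (h n hn).2.1.trans (h' n hn).2.1,
    (h n hn).2.2.trans (h' n hn).2.2⟩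

theorem Instr.frame {N : ℕ} {i : Instr} (hi : i.bound ≤ N) {μ ν : Memory}
    (h : μ.AgreeOn (· < N) ν) :
    (i.apply μ).AgreeOn (· < N) (i.apply ν) ∧ ν.AgreeOn (N ≤ ·) (i.apply ν) := by
  constructor
  · intro n hn
    have hn' := h n hn
    cases i
    case store a k j =>
      simp only [Instr.bound] at hi
      have ha := (h a (by omega)).2.2
      have hk := (h k (by omega)).2.1
      have hj := (h j (by omega)).1
      simp only [Instr.apply, Function.update_apply, ha, hk, hj]
      refine ⟨hn'.1, hn'.2.1, ?_⟩
      split_ifs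
      exacts [rfl, hn'.2.2]
    case load j a k =>
      simp only [Instr.bound] at hi
      have ha := (h a (by omega)).2.2
      have hk := (h k (by omega)).2.1
      simp only [Instr.apply, Function.update_apply, ha, hk]
      refine ⟨?_, hn'.2.1, hn'.2.2⟩
      split_ifs
      exacts [rfl, hn'.1]
    case const j c =>
      simp [Instr.apply, Function.update_apply, hn']
    case idxZero j =>
      simp [Instr.apply, Function.update_apply, hn']
    case add i j k | sub i j k | mul i j k | div i j k =>
      simp only [Instr.bound] at hi
      have hj := (h j (by omega)).1
      have hk := (h k (by omega)).1
      simp [Instr.apply, Function.update_apply, hn', hj, hk]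
    case exp i j | log i j =>
      simp only [Instr.bound] at hi
      have hj := (h j (by omega)).1
      simp [Instr.apply, Function.update_apply, hn', hj]
    case ofIdx i j | idxCopy i j =>
      simp only [Instr.bound] at hi
      have hj := (h j (by omega)).2.1
      simp [Instr.apply, Function.update_apply, hn', hj]
    case idxSucc j | idxPred j =>
      simp only [Instr.bound] at hi
      have hj := (h j (by omega)).2.1
      simp [Instr.apply, Function.update_apply, hn', hj]
  · intro n hn
    cases i <;> simp only [Instr.bound] at hi <;>
      exact ⟨by simp only [Instr.apply]; try rw [Function.update_of_ne (by omega)],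
        by simp only [Instr.apply]; try rw [Function.update_of_ne (by omega)],
        by simp only [Instr.apply]; try rw [Function.update_of_ne (by omega)]⟩

theorem Test.holds_congr {N : ℕ} {c : Test} (hc : c.bound ≤ N) {μ ν : Memory}
    (h : μ.AgreeOn (· < N) ν) : c.Holds μ ↔ c.Holds ν := by
  cases c with
  | regLt i j =>
    simp only [Test.bound] at hc
    simp [Test.Holds, (h i (by omega)).1, (h j (by omega)).1]
  | idxLt i j =>
    simp only [Test.bound] at hc
    simp [Test.Holds, (h i (by omega)).2.1, (h j (by omega)).2.1]

/-- A program that mentions only registers and arrays below `N` runs in the same way in every memory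
with the same contents below `N`, and leaves everything from `N` on untouched. -/
theorem Program.Runs.frame {P : Program} {μ μ' : Memory} {t : ℕ} (hP : P.Runs μ t μ') {N : ℕ}
    (hN : P.bound ≤ N) {ν : Memory} (h : μ.AgreeOn (· < N) ν) :
    ∃ ν', P.Runs ν t ν' ∧ μ'.AgreeOn (· < N) ν' ∧ ν.AgreeOn (N ≤ ·) ν' := by
  induction hP generalizing ν with
  | instr i μ =>
    exact ⟨_, .instr i ν, Instr.frame hN h⟩
  | seq _ _ ih₁ ih₂ =>
    simp only [Program.bound] at hN
    obtain ⟨ν₁, r₁, a₁, b₁⟩ := ih₁ (by omega) h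
    obtain ⟨ν₂, r₂, a₂, b₂⟩ := ih₂ (by omega) a₁
    exact ⟨ν₂, .seq r₁ r₂, a₂, b₁.trans b₂⟩
  | ite_pos hc _ ih =>
    simp only [Program.bound] at hN
    obtain ⟨ν₁, r₁, a₁, b₁⟩ := ih (by omega) h
    exact ⟨ν₁, .ite_pos ((Test.holds_congr (by omega) h).1 hc) r₁, a₁, b₁⟩
  | ite_neg hc _ ih =>
    simp only [Program.bound] at hN
    obtain ⟨ν₁, r₁, a₁, b₁⟩ := ih (by omega) h
    exact ⟨ν₁, .ite_neg (fun h' => hc ((Test.holds_congr (by omega) h).2 h')) r₁, a₁, b₁⟩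
  | loop_done hc =>
    simp only [Program.bound] at hN
    exact ⟨ν, .loop_done (fun h' => hc ((Test.holds_congr (by omega) h).2 h')), h,
      .refl _ _⟩
  | loop_step hc _ _ ih₁ ih₂ =>
    have hN' := hN
    simp only [Program.bound] at hN'
    obtain ⟨ν₁, r₁, a₁, b₁⟩ := ih₁ (by omega) h
    obtain ⟨ν₂, r₂, a₂, b₂⟩ := ih₂ hN a₁
    exact ⟨ν₂, .loop_step ((Test.holds_congr (by omega) h).1 hc) r₁ r₂, a₂, b₁.trans b₂⟩

/-- Index registers grow by at most one per step, so a program cannot produce an output that is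
longer than its input by more than its running time. -/
theorem Program.Runs.idx_le {P : Program} {μ μ' : Memory} {t : ℕ} (hP : P.Runs μ t μ') {B : ℕ}
    (hB : ∀ n, μ.idx n ≤ B) (n : ℕ) : μ'.idx n ≤ B + t := by
  induction hP generalizing B n with
  | instr i μ =>
    have h := hB n
    cases i
    case idxCopy j k =>
      have := hB k
      simp only [Instr.apply, Function.update_apply]
      split_ifs <;> omega
    case idxSucc j | idxPred j =>
      have := hB j
      simp only [Instr.apply, Function.update_apply]
      split_ifs <;> omega
    all_goals
      simp only [Instr.apply, Function.update_apply]
      try split_ifs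
      all_goals omega
  | seq _ _ ih₁ ih₂ => rw [← add_assoc]; exact ih₂ (ih₁ hB) n
  | ite_pos _ _ ih => exact (ih hB n).trans (by omega)
  | ite_neg _ _ ih => exact (ih hB n).trans (by omega)
  | loop_done => exact (hB n).trans (by omega)
  | loop_step _ _ _ ih₁ ih₂ => exact (ih₂ (ih₁ hB) n).trans (by omega)

theorem Program.ComputesWithin.length_le {P : Program} {l l' : List ℝ} {t : ℕ}
    (h : P.ComputesWithin l t l') : l'.length ≤ l.length + t := by
  obtain ⟨t', μ, ht, hr, ho, -⟩ := h
  have := hr.idx_le (B := l.length) (fun n => by simp only [Memory.init]; split_ifs <;> simp) 0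
  omega

/-- Straight-line code: the instruction `i` followed by a list of instructions. -/
def Program.block : Instr → List Instr → Program
  | i, [] => .instr i
  | i, j :: js => .seq (.instr i) (Program.block j js)

theorem Program.runs_block (i : Instr) (is : List Instr) (μ : Memory) :
    (Program.block i is).Runs μ (is.length + 1) (is.foldl (fun μ j => j.apply μ) (i.apply μ)) := by
  induction is generalizing i μ with
  | nil => exact .instr i μ
  | cons j js ih =>
    have := Program.Runs.seq (.instr i μ) (ih j (i.apply μ))
    rw [add_comm] at this
    exact this

/-! ### Presentations -/

theorem IsListing.sum_map {α A : Type} [Fintype α] [AddCommMonoid A] {L : List α}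
    (h : IsListing L) (g : α → A) : (L.map g).sum = ∑ a, g a := by
  classical
  rw [← List.sum_toFinset g h.1]
  congr 1
  ext a
  simp [h.2 a]

theorem IsListing.length_eq {α : Type} [Fintype α] {L : List α} (h : IsListing L) :
    L.length = Fintype.card α := by
  classical
  rw [← List.toFinset_card_of_nodup h.1, ← Finset.card_univ]
  congr 1
  ext a
  simp [h.2 a]

theorem isListing_univ_toList (α : Type) [Fintype α] :
    IsListing (Finset.univ : Finset α).toList :=
  ⟨Finset.nodup_toList _, fun _ => by simp⟩

theorem sum_map_flatMap {α β A : Type} [AddCommMonoid A] (L : List α) (f : α → List β)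
    (g : β → A) : ((L.flatMap f).map g).sum = (L.map fun a => ((f a).map g).sum).sum := by
  induction L with
  | nil => rfl
  | cons a L ih => simp [ih]

/-- The sum of `φ x` over all entries `x` of a presentation of `S`; by
`PresentsSystem.sum_map` it does not depend on the presentation. -/
def SpinSystem.entrySum {A : Type} [AddCommMonoid A] {q : ℕ} (S : SpinSystem q) (φ : ℝ → A) : A :=
  φ q + φ S.graph.V.card + ∑ v : S.graph.V, φ (v : ℕ) + φ S.graph.E.card +
    ∑ e : S.graph.E, (φ e.1.card + ∑ v : e.1, φ (v.1 : ℕ) + φ (q ^ e.1.card : ℕ) +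
      ∑ s : e.1 → Fin q, (∑ v : e.1, φ (stateReal (s v)) + φ (S.J e s)))

theorem PresentsSystem.sum_map {A : Type} [AddCommMonoid A] {q : ℕ} {S : SpinSystem q}
    {l : List ℝ} (h : PresentsSystem S l) (φ : ℝ → A) : (l.map φ).sum = S.entrySum φ := by
  obtain ⟨LV, LE, Le, Lc, hV, hE, he, hc, rfl⟩ := h
  simp only [List.map_append, List.sum_append, sum_map_flatMap, hV.length_eq, hE.length_eq,
    (he _).length_eq, (hc _).length_eq, hE.sum_map, List.map_map, (he _).sum_map, (hc _).sum_map,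
    hV.sum_map, List.map_cons, List.map_nil, List.sum_cons, List.sum_nil, Function.comp_apply,
    Fintype.card_coe, Fintype.card_pi, Fintype.card_fin, Finset.prod_const, Finset.card_univ,
    add_zero, SpinSystem.entrySum]

theorem SpinSystem.exists_presentsSystem {q : ℕ} (S : SpinSystem q) :
    ∃ l, PresentsSystem S l :=
  ⟨_, _, _, fun _ => _, fun _ => _, isListing_univ_toList _, isListing_univ_toList _,
    fun _ => isListing_univ_toList _, fun _ => isListing_univ_toList _, rfl⟩

theorem PresentsSystem.length_eq {q : ℕ} {S : SpinSystem q} {l : List ℝ}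
    (h : PresentsSystem S l) : l.length = 3 + S.graph.V.card +
      ∑ e : S.graph.E, (2 + e.1.card + q ^ e.1.card * (e.1.card + 1)) := by
  have := h.sum_map (fun _ => 1)
  simp only [SpinSystem.entrySum, List.map_const', List.sum_replicate, smul_eq_mul, mul_one,
    Finset.sum_const, Finset.card_univ, Fintype.card_coe, Fintype.card_pi, Fintype.card_fin,
    Finset.prod_const] at this
  rw [this]
  have e : ∀ e : S.graph.E, 1 + e.1.card + 1 + q ^ e.1.card * (e.1.card + 1) =
      2 + e.1.card + q ^ e.1.card * (e.1.card + 1) := fun e => by ring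
  simp only [e]
  ring

theorem SpinSystem.size_eq {q : ℕ} (S : SpinSystem q) :
    S.size = ∑ e : S.graph.E, q ^ e.1.card :=
  (Finset.sum_coe_sort S.graph.E fun e => q ^ e.card).symm

theorem SpinSystem.card_V_le_size {q : ℕ} (S : SpinSystem q) : S.graph.V.card ≤ S.size := by
  classical
  have hsub : (Finset.univ : Finset S.graph.V) ⊆ S.graph.E.biUnion id := fun v _ => by
    simpa using S.graph.no_isolated v
  calc S.graph.V.card = (Finset.univ : Finset S.graph.V).card := by simp
    _ ≤ (S.graph.E.biUnion id).card := Finset.card_le_card hsub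
    _ ≤ ∑ e ∈ S.graph.E, e.card := Finset.card_biUnion_le
    _ ≤ S.size := Finset.sum_le_sum fun e _ => (Nat.lt_pow_self S.two_le).le

theorem PresentsSystem.size_le_length {q : ℕ} {S : SpinSystem q} {l : List ℝ}
    (h : PresentsSystem S l) : S.size ≤ l.length := by
  rw [h.length_eq, S.size_eq]
  refine le_add_left (Finset.sum_le_sum fun e _ => ?_)
  nlinarith [Nat.zero_le (q ^ e.1.card * e.1.card)]

theorem PresentsSystem.card_V_le_length {q : ℕ} {S : SpinSystem q} {l : List ℝ}
    (h : PresentsSystem S l) : S.graph.V.card ≤ l.length := by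
  rw [h.length_eq]; omega

theorem PresentsSystem.length_le {q : ℕ} {S : SpinSystem q} {l : List ℝ}
    (h : PresentsSystem S l) : l.length ≤ S.size ^ 2 + 5 * S.size + 3 := by
  have hV := S.card_V_le_size
  have hE : ∑ e : S.graph.E, (2 + e.1.card + q ^ e.1.card * (e.1.card + 1)) ≤
      S.size ^ 2 + 4 * S.size := by
    calc _ ≤ ∑ e : S.graph.E, (q ^ e.1.card * S.size + 4 * q ^ e.1.card) := by
          refine Finset.sum_le_sum fun e _ => ?_
          have h1 : e.1.card < q ^ e.1.card := Nat.lt_pow_self S.two_le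
          have h2 : q ^ e.1.card ≤ S.size := by
            rw [S.size_eq]
            exact Finset.single_le_sum (f := fun e : S.graph.E => q ^ e.1.card)
              (fun _ _ => Nat.zero_le _) (Finset.mem_univ e)
          have h3 := Nat.mul_le_mul_left (q ^ e.1.card) (h1.le.trans h2)
          rw [mul_add]
          omega
      _ = S.size ^ 2 + 4 * S.size := by
          rw [Finset.sum_add_distrib, ← Finset.sum_mul, ← Finset.mul_sum, ← S.size_eq, sq]
  rw [h.length_eq]
  omega

/-- The sum of `x + 1` over all entries `x` of a presentation of `S`. It is easy to compute, does
not depend on the presentation, and bounds both the length of the presentation and the energies. -/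
noncomputable def SpinSystem.weight {q : ℕ} (S : SpinSystem q) : ℝ := S.entrySum fun x => x + 1

theorem PresentsSystem.entry_nonneg {q : ℕ} {S : SpinSystem q} {l : List ℝ}
    (h : PresentsSystem S l) : ∀ x ∈ l, 0 ≤ x := by
  obtain ⟨LV, LE, Le, Lc, -, -, -, -, rfl⟩ := h
  intro x hx
  simp only [List.mem_append, List.mem_cons, List.mem_map, List.mem_flatMap, List.not_mem_nil,
    or_false, stateReal] at hx
  rcases hx with (((rfl | rfl) | ⟨v, -, rfl⟩) | rfl) |
    ⟨e, -, (((rfl | ⟨v, -, rfl⟩) | rfl) | ⟨s, -, ⟨v, -, rfl⟩ | rfl⟩)⟩ <;> positivity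

theorem PresentsSystem.length_le_weight {q : ℕ} {S : SpinSystem q} {l : List ℝ}
    (h : PresentsSystem S l) : (l.length : ℝ) ≤ S.weight := by
  have h1 := List.card_nsmul_le_sum (l.map fun x => x + 1) 1 (by
    intro x hx
    obtain ⟨y, hy, rfl⟩ := List.mem_map.1 hx
    have := h.entry_nonneg y hy
    linarith)
  rw [h.sum_map] at h1
  simpa [SpinSystem.weight] using h1

theorem SpinSystem.hamiltonian_le_weight {q : ℕ} (S : SpinSystem q) (s : S.Config) :
    S.hamiltonian s ≤ S.weight := by
  have hs : ∀ {e : S.graph.E} (s : e.1 → Fin q),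
      0 ≤ ∑ v : e.1, (stateReal (s v) + 1) := fun s =>
    Finset.sum_nonneg fun v _ => by unfold stateReal; positivity
  have hE : S.hamiltonian s ≤ ∑ e : S.graph.E, (((e.1.card : ℝ) + 1) +
      ∑ v : e.1, (((v.1 : ℕ) : ℝ) + 1) + (((q ^ e.1.card : ℕ) : ℝ) + 1) +
      ∑ s : e.1 → Fin q, (∑ v : e.1, (stateReal (s v) + 1) + ((S.J e s : ℝ) + 1))) := by
    refine Finset.sum_le_sum fun e _ => ?_
    have h1 := Finset.single_le_sum
      (f := fun s : e.1 → Fin q => ∑ v : e.1, (stateReal (s v) + 1) + ((S.J e s : ℝ) + 1))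
      (fun s _ => add_nonneg (hs s) (by positivity)) (Finset.mem_univ fun v : e.1 => s v.1)
    have h2 := hs fun v : e.1 => s v.1
    have h3 : (0 : ℝ) ≤ ((e.1.card : ℝ) + 1) + ∑ v : e.1, (((v.1 : ℕ) : ℝ) + 1) +
      (((q ^ e.1.card : ℕ) : ℝ) + 1) := by positivity
    linarith
  have h4 : (0 : ℝ) ≤ ((q : ℝ) + 1) + ((S.graph.V.card : ℝ) + 1) +
    ∑ v : S.graph.V, (((v : ℕ) : ℝ) + 1) + ((S.graph.E.card : ℝ) + 1) := by positivity
  unfold SpinSystem.weight SpinSystem.entrySum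
  linarith

/-! ### Partition functions of source and target of a simulation -/

namespace Simulation

variable {q q' : ℕ} {S : SpinSystem q} {T : SpinSystem q'}

/-- `s ∈ sim_i(t)`: the physical spins of `s` encode `t` with the `i`-th encoding, and `s` has low
energy. -/
def Mem (f : Simulation S T) (i : Fin f.data.coding.number) (t : T.Config) (s : S.Config) : Prop :=
  (∀ v j, s ⟨f.data.phys v j, f.phys_mem v j⟩ = f.data.coding.enc i (t v) j) ∧
    S.hamiltonian s - f.shift < f.cutoff

theorem Mem.enc_eq {f : Simulation S T} {i j : Fin f.data.coding.number} {t t' : T.Config}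
    {s : S.Config} (h : f.Mem i t s) (h' : f.Mem j t' s) (v : T.graph.V) :
    f.data.coding.enc i (t v) = f.data.coding.enc j (t' v) :=
  funext fun k => (h.1 v k).symm.trans (h'.1 v k)

theorem Mem.config_unique {f : Simulation S T} {i j : Fin f.data.coding.number} {t t' : T.Config}
    {s : S.Config} (h : f.Mem i t s) (h' : f.Mem j t' s) : t = t' := by
  funext v
  rw [← f.dec_enc i (t v), h.enc_eq h' v, f.dec_enc]

/-- The number of pairwise disjoint sets among `sim_1(t), …, sim_m(t)`. These sets are disjoint as
soon as `T` has a spin, and all equal if it has none. -/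
def multiplicity (f : Simulation S T) : ℕ :=
  if T.graph.V.Nonempty then f.data.coding.number else 1

theorem multiplicity_pos (f : Simulation S T) : 0 < f.multiplicity := by
  unfold multiplicity
  split_ifs
  exacts [f.number_pos, one_pos]

/-- There are encodings that yield every low energy configuration exactly once. -/
theorem exists_transversal (f : Simulation S T) :
    ∃ I : Finset (Fin f.data.coding.number), I.card = f.multiplicity ∧
      (∀ i t s, f.Mem i t s → ∃ i' ∈ I, f.Mem i' t s) ∧
      ∀ i ∈ I, ∀ j ∈ I, ∀ t t' s, f.Mem i t s → f.Mem j t' s → i = j := by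
  by_cases hV : T.graph.V.Nonempty
  · refine ⟨Finset.univ, by simp [multiplicity, hV], fun i t s h => ⟨i, Finset.mem_univ i, h⟩, ?_⟩
    intro i _ j _ t t' s h h'
    obtain ⟨v, hv⟩ := hV
    have e := h.enc_eq h' ⟨v, hv⟩
    rw [h.config_unique h'] at e
    exact f.enc_disjoint i j _ e
  · refine ⟨{⟨0, f.number_pos⟩}, by simp [multiplicity, hV], fun i t s h => ?_, ?_⟩
    · exact ⟨_, Finset.mem_singleton_self _, fun v => absurd ⟨v.1, v.2⟩ hV, h.2⟩
    · intro i hi j hj _ _ _ _ _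
      rw [Finset.mem_singleton.1 hi, Finset.mem_singleton.1 hj]

/-- If the cut-off exceeds the energies of `T`, then the low energy configurations of `S` contribute
`e^{-βΓ} m d Z_T(β)` to `Z_S(β)`, and each other configuration at most `e^{-β(Γ + Δ)}`. -/
theorem partitionFunction_approx (f : Simulation S T) {β : ℝ} (hβ : 0 < β)
    (hf : ∀ t, T.hamiltonian t < f.cutoff) :
    |S.partitionFunction β - Real.exp (-β * f.shift) * f.multiplicity * f.data.degeneracy *
        T.partitionFunction β| ≤
      Real.exp (-β * f.shift) * (q ^ S.graph.V.card * Real.exp (-β * f.cutoff)) := by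
  classical
  obtain ⟨I, hI, hcover, hinj⟩ := f.exists_transversal
  let sim (p : Fin f.data.coding.number × T.Config) : Finset S.Config :=
    Finset.univ.filter fun s => f.Mem p.1 p.2 s
  have hdisj : ((I ×ˢ Finset.univ : Finset (Fin f.data.coding.number × T.Config)) :
      Set _).PairwiseDisjoint sim := by
    rintro ⟨i, t⟩ hp ⟨j, t'⟩ hp' hne
    refine Finset.disjoint_left.2 fun s hs hs' => hne ?_
    have h : f.Mem i t s := (Finset.mem_filter.1 hs).2
    have h' : f.Mem j t' s := (Finset.mem_filter.1 hs').2
    have hi : i ∈ I := (Finset.mem_product.1 hp).1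
    have hj : j ∈ I := (Finset.mem_product.1 hp').1
    rw [hinj i hi j hj t t' s h h', h.config_unique h']
  have hcard (i : Fin f.data.coding.number) (t : T.Config) :
      (sim (i, t)).card = f.data.degeneracy := by
    rw [← f.local_degeneracy i t (hf t), ← Set.ncard_coe_finset]
    congr 1
    ext s
    simp [sim, Mem]
  set low := (I ×ˢ Finset.univ).biUnion sim with hlow
  have hsum : ∑ s ∈ low, Real.exp (-β * S.hamiltonian s) =
      Real.exp (-β * f.shift) * f.multiplicity * f.data.degeneracy * T.partitionFunction β := by
    rw [hlow, Finset.sum_biUnion hdisj, Finset.sum_product]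
    have h1 (i : Fin f.data.coding.number) (t : T.Config) :
        ∑ s ∈ sim (i, t), Real.exp (-β * S.hamiltonian s) =
          f.data.degeneracy * (Real.exp (-β * f.shift) * Real.exp (-β * T.hamiltonian t)) := by
      rw [← hcard i t, ← nsmul_eq_mul, ← Finset.sum_const]
      refine Finset.sum_congr rfl fun s hs => ?_
      have h : f.Mem i t s := (Finset.mem_filter.1 hs).2
      rw [← Real.exp_add, ← f.energy_low i t s h.1 h.2]
      congr 1
      ring
    simp only [h1, ← Finset.mul_sum, Finset.sum_const, nsmul_eq_mul, hI]
    unfold SpinSystem.partitionFunction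
    ring
  have hhigh : ∀ s ∈ lowᶜ, Real.exp (-β * S.hamiltonian s) ≤
      Real.exp (-β * f.shift) * Real.exp (-β * f.cutoff) := by
    intro s hs
    have h := f.energy_high s (by
      rintro ⟨i, t, h⟩
      obtain ⟨i', hi', h'⟩ := hcover i t s h
      refine Finset.mem_compl.1 hs (Finset.mem_biUnion.2 ⟨(i', t), ?_, ?_⟩)
      · exact Finset.mem_product.2 ⟨hi', Finset.mem_univ t⟩
      · exact Finset.mem_filter.2 ⟨Finset.mem_univ s, h'⟩)
    rw [← Real.exp_add, Real.exp_le_exp]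
    nlinarith
  have htotal : S.partitionFunction β = ∑ s ∈ low, Real.exp (-β * S.hamiltonian s) +
      ∑ s ∈ lowᶜ, Real.exp (-β * S.hamiltonian s) :=
    (Finset.sum_add_sum_compl low _).symm
  rw [htotal, hsum, add_sub_cancel_left,
    abs_of_nonneg (Finset.sum_nonneg fun s _ => (Real.exp_pos _).le)]
  have hle : (lowᶜ.card : ℝ) ≤ q ^ S.graph.V.card := by
    have h := Finset.card_le_univ lowᶜ
    rw [Fintype.card_pi] at h
    simp only [Fintype.card_fin, Finset.prod_const, Finset.card_univ, Fintype.card_coe] at h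
    exact_mod_cast h
  calc _ ≤ lowᶜ.card • (Real.exp (-β * f.shift) * Real.exp (-β * f.cutoff)) :=
        Finset.sum_le_card_nsmul _ _ _ hhigh
    _ = Real.exp (-β * f.shift) * (lowᶜ.card * Real.exp (-β * f.cutoff)) := by
        rw [nsmul_eq_mul]; ring
    _ ≤ _ := by gcongr

/-- If the error term is small enough, rescaling turns `ε/2`-approximations of `Z_S(β)` into
`ε`-approximations of `Z_T(β)`. -/
theorem isApprox_rescale (f : Simulation S T) {β ε z : ℝ} (hβ : 0 < β) (hε : 0 < ε)
    (hf : ∀ t, T.hamiltonian t < f.cutoff)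
    (herr : (1 + ε / 2) * (q ^ S.graph.V.card * Real.exp (-β * f.cutoff)) <
      ε / 2 * T.partitionFunction β)
    (hz : IsApprox (ε / 2) (S.partitionFunction β) z) :
    IsApprox ε (T.partitionFunction β)
      (z / (Real.exp (-β * f.shift) * f.multiplicity * f.data.degeneracy)) := by
  have happ := f.partitionFunction_approx hβ hf
  unfold IsApprox at hz ⊢
  have hG : 0 < Real.exp (-β * f.shift) := Real.exp_pos _
  have hM : (1 : ℝ) ≤ f.multiplicity := by exact_mod_cast f.multiplicity_pos
  have hd : (1 : ℝ) ≤ f.data.degeneracy := by exact_mod_cast f.degeneracy_pos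
  set G := Real.exp (-β * f.shift)
  set A := G * f.multiplicity * f.data.degeneracy
  set R := (q : ℝ) ^ S.graph.V.card * Real.exp (-β * f.cutoff)
  set ZS := S.partitionFunction β
  set ZT := T.partitionFunction β
  have hGA : G ≤ A := by
    calc G = G * 1 * 1 := by ring
      _ ≤ G * f.multiplicity * f.data.degeneracy := by gcongr
  have hA : 0 < A := hG.trans_le hGA
  have hR : 0 ≤ R := by positivity
  have hGR : G * R ≤ A * R := by gcongr
  obtain ⟨h1, h2⟩ := abs_le.1 happ
  obtain ⟨h3, h4⟩ := abs_lt.1 hz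
  have key := mul_lt_mul_of_pos_left herr hA
  have h5 : ε / 2 * (ZS - A * ZT) ≤ ε / 2 * (A * R) :=
    mul_le_mul_of_nonneg_left (h2.trans hGR) (by positivity)
  rw [div_sub' hA.ne', abs_div, abs_of_pos hA, div_lt_iff₀ hA, abs_lt]
  constructor <;> linarith

end Simulation

/-! ### The choice of the cut-off -/

theorem SpinSystem.exp_neg_weight_le {q : ℕ} (S : SpinSystem q) {β : ℝ} (hβ : 0 < β) :
    Real.exp (-β * S.weight) ≤ S.partitionFunction β := by
  let s : S.Config := fun _ => ⟨0, by have := S.two_le; omega⟩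
  calc Real.exp (-β * S.weight) ≤ Real.exp (-β * S.hamiltonian s) := by
        have := S.hamiltonian_le_weight s
        exact Real.exp_le_exp.2 (by nlinarith)
    _ ≤ S.partitionFunction β :=
        Finset.single_le_sum (f := fun s : S.Config => Real.exp (-β * S.hamiltonian s))
          (fun _ _ => (Real.exp_pos _).le) (Finset.mem_univ s)

theorem SpinSystem.weight_nonneg {q : ℕ} (S : SpinSystem q) : 0 ≤ S.weight := by
  obtain ⟨l, hl⟩ := S.exists_presentsSystem
  exact (Nat.cast_nonneg _).trans hl.length_le_weight

theorem exists_polynomial_le_exp (p : Polynomial ℕ) :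
    ∃ C : ℝ, 0 ≤ C ∧ ∀ n : ℕ, ((p.eval n : ℕ) : ℝ) ≤ C * Real.exp n := by
  induction p using Polynomial.induction_on' with
  | add p r hp hr =>
    obtain ⟨C, hC, h⟩ := hp
    obtain ⟨D, hD, h'⟩ := hr
    refine ⟨C + D, by positivity, fun n => ?_⟩
    rw [Polynomial.eval_add, Nat.cast_add, add_mul]
    exact add_le_add (h n) (h' n)
  | monomial k a =>
    refine ⟨a * k.factorial, by positivity, fun n => ?_⟩
    have h := Real.pow_div_factorial_le_exp (n : ℝ) (Nat.cast_nonneg n) k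
    rw [div_le_iff₀ (by positivity)] at h
    rw [Polynomial.eval_monomial]
    push_cast
    calc (a : ℝ) * n ^ k ≤ a * (Real.exp n * k.factorial) := by gcongr
      _ = _ := by ring

/-- The cut-off `W + (C e^W + 1 + 2/ε) / β`, where `W` is the weight of `T`. Above `W`, it has room
for `C e^W`, which beats the number of source configurations, and for `2/ε`, which beats
`log (1 + 2/ε)`. -/
noncomputable def cutoffValue (C : ℝ) {q : ℕ} (T : SpinSystem q) (β ε : ℝ) : ℝ :=
  T.weight + (C * Real.exp T.weight + 1 + 2 / ε) / β

theorem weight_lt_cutoffValue {C : ℝ} (hC : 0 ≤ C) {q : ℕ} (T : SpinSystem q) {β ε : ℝ}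
    (hβ : 0 < β) (hε : 0 < ε) : T.weight < cutoffValue C T β ε :=
  lt_add_of_pos_right _ (by positivity)

/-- The error term is small because `1 + ε/2 ≤ (ε/2) e^{2/ε}`, `q ^ n ≤ e^{q n}` and
`Z_T(β) ≥ e^{-βW}`. -/
theorem error_lt {C : ℝ} {q q' n : ℕ} (T : SpinSystem q') {β ε : ℝ} (hβ : 0 < β) (hε : 0 < ε)
    (hn : (q * n : ℕ) ≤ C * Real.exp T.weight) :
    (1 + ε / 2) * (q ^ n * Real.exp (-β * cutoffValue C T β ε)) <
      ε / 2 * T.partitionFunction β := by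
  have h1 : 1 + ε / 2 ≤ ε / 2 * Real.exp (2 / ε) := by
    have := mul_le_mul_of_nonneg_left (Real.add_one_le_exp (2 / ε)) (half_pos hε).le
    have e : ε / 2 * (2 / ε + 1) = 1 + ε / 2 := by field_simp
    linarith
  have h2 : (q : ℝ) ^ n ≤ Real.exp (q * n : ℕ) := by
    have : (q : ℝ) ≤ Real.exp q := by linarith [Real.add_one_le_exp (q : ℝ)]
    calc (q : ℝ) ^ n ≤ Real.exp q ^ n := by gcongr
      _ = _ := by rw [← Real.exp_nat_mul]; push_cast; ring_nf
  have h3 : -β * cutoffValue C T β ε =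
      -β * T.weight + (-(C * Real.exp T.weight) - 1 - 2 / ε) := by
    unfold cutoffValue
    field_simp
    ring
  calc (1 + ε / 2) * (q ^ n * Real.exp (-β * cutoffValue C T β ε))
      ≤ ε / 2 * Real.exp (2 / ε) *
          (Real.exp (q * n : ℕ) * Real.exp (-β * cutoffValue C T β ε)) := by gcongr
    _ = ε / 2 * Real.exp (2 / ε + ((q * n : ℕ) + -β * cutoffValue C T β ε)) := by
        rw [Real.exp_add, Real.exp_add]; ring
    _ < ε / 2 * Real.exp (-β * T.weight) := by
        refine mul_lt_mul_of_pos_left (Real.exp_lt_exp.2 ?_) (half_pos hε)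
        rw [h3]
        linarith
    _ ≤ _ := mul_le_mul_of_nonneg_left (T.exp_neg_weight_le hβ) (half_pos hε).le

/-! ### The programs of the reduction

The scratch registers of these programs are numbered from `N` on, where `N` bounds the registers of
the emulation. Real registers: `N` holds `ε`, `N + 1` the approximation `z`, `N + 2` the inverse
temperature `β`, `N + 3` the number of spins of `T`, `N + 4` the weight of `T`, `N + 6` the
constant `1`; the others are auxiliary. -/

namespace Program

theorem Runs.cast {P : Program} {μ μ' : Memory} {t t' : ℕ} (h : P.Runs μ t μ') (e : t = t') :
    P.Runs μ t' μ' := e ▸ h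

/-- Move the entries of array `0` from cell `idx (N + 1)` on to cell `idx N`, and accumulate
`x + 1` for every entry `x`. -/
def shiftLoop (N : ℕ) : Program :=
  .loop (.idxLt (N + 1) 0) (.block (.load (N + 5) 0 (N + 1)) [.store 0 N (N + 5),
    .add (N + 4) (N + 4) (N + 5), .add (N + 4) (N + 4) (N + 6), .idxSucc N, .idxSucc (N + 1)])

/-- Since the destination lies below the source, no entry is overwritten before it is read. -/
theorem runs_shiftLoop {N : ℕ} (hN : 0 < N) (l : List ℝ) (μ : Memory)
    (hlen : μ.idx (N + 1) + l.length = μ.idx 0)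
    (harr : ∀ n < l.length, μ.arr 0 (μ.idx (N + 1) + n) = l.getD n 0)
    (hidx : μ.idx N < μ.idx (N + 1)) (hone : μ.reg (N + 6) = 1) :
    ∃ μ', (shiftLoop N).Runs μ (7 * l.length + 1) μ' ∧
      (∀ i, i ≠ N + 4 → i ≠ N + 5 → μ'.reg i = μ.reg i) ∧
      μ'.reg (N + 4) = μ.reg (N + 4) + (l.map fun x => x + 1).sum ∧
      (∀ i, i ≠ N → i ≠ N + 1 → μ'.idx i = μ.idx i) ∧
      μ'.idx N = μ.idx N + l.length ∧ (∀ i, i ≠ 0 → μ'.arr i = μ.arr i) ∧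
      ∀ n, μ'.arr 0 n = if μ.idx N ≤ n ∧ n < μ.idx N + l.length then l.getD (n - μ.idx N) 0
        else μ.arr 0 n := by
  induction l generalizing μ with
  | nil =>
    refine ⟨μ, .loop_done ?_, fun _ _ _ => rfl, by simp, fun _ _ _ => rfl, by simp,
      fun _ _ => rfl, fun n => ?_⟩
    · simp only [Test.Holds]
      simp only [List.length_nil] at hlen
      omega
    · rw [if_neg]
      simp only [List.length_nil]
      omega
  | cons x l ih =>
    have hx := harr 0 (by simp)
    simp only [add_zero, List.getD_cons_zero] at hx
    simp only [List.length_cons] at hlen harr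
    have hstep := runs_block (.load (N + 5) 0 (N + 1)) [.store 0 N (N + 5),
      .add (N + 4) (N + 4) (N + 5), .add (N + 4) (N + 4) (N + 6), .idxSucc N, .idxSucc (N + 1)] μ
    set ν := [Instr.store 0 N (N + 5), .add (N + 4) (N + 4) (N + 5),
      .add (N + 4) (N + 4) (N + 6), .idxSucc N, .idxSucc (N + 1)].foldl
        (fun μ j => j.apply μ) (Instr.apply (.load (N + 5) 0 (N + 1)) μ) with hν
    have hreg : ∀ i, i ≠ N + 4 → i ≠ N + 5 → ν.reg i = μ.reg i := fun i h4 h5 => by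
      simp [hν, Instr.apply, h4, h5]
    have hreg4 : ν.reg (N + 4) = μ.reg (N + 4) + (x + 1) := by
      simp [hν, Instr.apply, hx, hone, add_assoc]
    have hi : ∀ i, i ≠ N → i ≠ N + 1 → ν.idx i = μ.idx i := fun i h0 h1 => by
      simp [hν, Instr.apply, h0, h1]
    have hiN : ν.idx N = μ.idx N + 1 := by
      simp [hν, Instr.apply]
    have hiN1 : ν.idx (N + 1) = μ.idx (N + 1) + 1 := by
      simp [hν, Instr.apply]
    have ha : ∀ i, i ≠ 0 → ν.arr i = μ.arr i := fun i h0 => by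
      simp [hν, Instr.apply, h0]
    have ha0 : ∀ n, ν.arr 0 n = if n = μ.idx N then x else μ.arr 0 n := fun n => by
      simp [hν, Instr.apply, Function.update_apply, hx]
    obtain ⟨μ', hr, g1, g2, g3, g4, g5, g6⟩ := ih ν
      (by rw [hiN1, hi 0 hN.ne (by omega)]; omega)
      (fun n hn => by
        rw [hiN1, ha0, if_neg (by omega), add_assoc, harr (1 + n) (by omega), add_comm 1 n,
          List.getD_cons_succ])
      (by omega) (by rw [hreg _ (by omega) (by omega), hone])
    refine ⟨μ', ?_, fun i h4 h5 => ?_, ?_, fun i h0 h1 => ?_, ?_, fun i h0 => ?_, fun n => ?_⟩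
    · have h := Runs.loop_step (c := .idxLt (N + 1) 0) (by simp only [Test.Holds]; omega) hstep hr
      exact h.cast (by simp only [List.length_cons, List.length_nil]; omega)
    · rw [g1 i h4 h5, hreg i h4 h5]
    · rw [g2, hreg4, List.map_cons, List.sum_cons]; ring
    · rw [g3 i h0 h1, hi i h0 h1]
    · rw [g4, hiN, List.length_cons]; omega
    · rw [g5 i h0, ha i h0]
    · rw [g6, hiN, ha0, List.length_cons]
      rcases Nat.lt_trichotomy n (μ.idx N) with h | h | h
      · rw [if_neg (by omega), if_neg (by omega), if_neg (by omega)]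
      · rw [if_neg (by omega), if_pos h, if_pos (by omega), h, Nat.sub_self,
          List.getD_cons_zero]
      · obtain ⟨k, rfl⟩ : ∃ k, n = μ.idx N + (k + 1) := ⟨n - μ.idx N - 1, by omega⟩
        rw [Nat.add_sub_cancel_left, List.getD_cons_succ,
          show μ.idx N + (k + 1) - (μ.idx N + 1) = k by omega]
        by_cases hk : k < l.length
        · rw [if_pos (by omega), if_pos (by omega)]
        · rw [if_neg (by omega), if_neg (by omega), if_neg (by omega)]

/-- The straight-line code after `shiftLoop`: set the length of the input of the emulation, clear
the two cells behind it (the header of at most three entries becomes a single one, and unused cells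
of an initial memory are zero), compute the cut-off and store it in cell `0`. -/
def storeCutoff (C : ℝ) (N : ℕ) : Program :=
  .block (.idxCopy 0 N) [.const (N + 5) 0, .store 0 N (N + 5), .idxSucc N, .store 0 N (N + 5),
    .exp (N + 5) (N + 4), .const (N + 7) C, .mul (N + 5) (N + 7) (N + 5),
    .add (N + 5) (N + 5) (N + 6), .const (N + 7) 2, .div (N + 7) (N + 7) N,
    .add (N + 5) (N + 5) (N + 7), .div (N + 5) (N + 5) (N + 2), .add (N + 4) (N + 4) (N + 5),
    .idxZero N, .store 0 N (N + 4)]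

/-- Replace the input by the input `(T, δ)` of the emulation. -/
def prepare (C : ℝ) (N : ℕ) : Program := .seq (shiftLoop N) (storeCutoff C N)

/-- The state in which `prepare` starts: array `0` holds a header of `k` entries, followed by
`l`, and `ε`, `β` have been read. -/
structure Ready (N k : ℕ) (l : List ℝ) (ε β : ℝ) (μ : Memory) : Prop where
  two_le : 2 ≤ k
  le_three : k ≤ 3
  dest : μ.idx N = 1
  source : μ.idx (N + 1) = k
  length : μ.idx 0 = k + l.length
  cells : ∀ n, μ.arr 0 (k + n) = l.getD n 0
  eps : μ.reg N = ε
  beta : μ.reg (N + 2) = β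
  weight : μ.reg (N + 4) = 0
  one : μ.reg (N + 6) = 1
  reg_zero : ∀ i < N, μ.reg i = 0
  idx_zero : ∀ i < N, i ≠ 0 → μ.idx i = 0
  arr_zero : ∀ i, i ≠ 0 → μ.arr i = fun _ => 0

/-- After `prepare`, everything below `N` is as in the initial memory of the emulation on input
`(T, δ)`. -/
theorem runs_prepare {N : ℕ} (hN : 0 < N) {C : ℝ} {k : ℕ} {l : List ℝ} {ε β : ℝ} {μ : Memory}
    (h : Ready N k l ε β μ) {W : ℝ} (hW : (l.map fun x => x + 1).sum = W) :
    ∃ μ', (prepare C N).Runs μ (7 * l.length + 17) μ' ∧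
      (Memory.init ((W + (C * Real.exp W + 1 + 2 / ε) / β) :: l)).AgreeOn (· < N) μ' ∧
      μ'.reg (N + 1) = μ.reg (N + 1) ∧ μ'.reg (N + 2) = μ.reg (N + 2) ∧
      μ'.reg (N + 3) = μ.reg (N + 3) := by
  have hk := h.two_le
  have hk' := h.le_three
  obtain ⟨ν, hr, g1, g2, g3, g4, g5, g6⟩ := runs_shiftLoop hN l μ
    (by rw [h.source, h.length]) (fun n _ => by rw [h.source, h.cells])
    (by rw [h.source, h.dest]; omega) h.one
  rw [h.dest] at g4 g6
  rw [h.weight, zero_add, hW] at g2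
  have e0 := (g1 N (by omega) (by omega)).trans h.eps
  have e1 := g1 (N + 1) (by omega) (by omega)
  have e2 := (g1 (N + 2) (by omega) (by omega)).trans h.beta
  have e3 := g1 (N + 3) (by omega) (by omega)
  have e6 := (g1 (N + 6) (by omega) (by omega)).trans h.one
  refine ⟨_, (Runs.seq hr (runs_block _ _ _)).cast rfl, ?_, ?_, ?_, ?_⟩
  · intro i hi
    have hne : ∀ j, ¬ i = N + j := fun j => by omega
    have hne' : ¬ i = N := by omega
    refine ⟨?_, ?_, ?_⟩
    · have : ν.reg i = 0 := by rw [g1 i (hne 4) (hne 5), h.reg_zero i hi]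
      simp [Memory.init, Instr.apply, Function.update_apply, hne, this]
    · by_cases h0 : i = 0
      · subst h0
        simp [Memory.init, Instr.apply, Function.update_apply, hne', g4, add_comm]
      · have : ν.idx i = 0 := by rw [g3 i hne' (hne 1), h.idx_zero i hi h0]
        simp [Memory.init, Instr.apply, Function.update_apply, hne', h0, this]
    · by_cases h0 : i = 0
      · subst h0
        funext n
        trans if n = 0 then W + (C * Real.exp W + 1 + 2 / ε) / β else
          if n = 1 + l.length + 1 then 0 else if n = 1 + l.length then 0 else ν.arr 0 n
        swap
        · simp [Instr.apply, Function.update_apply, hN.ne', g4, g2, e0, e2, e6]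
        simp only [Memory.init, if_true]
        rcases n with _ | n
        · simp
        · rw [if_neg n.succ_ne_zero, List.getD_cons_succ]
          by_cases h1 : n + 1 = 1 + l.length + 1
          · rw [if_pos h1, List.getD_eq_default _ _ (by omega)]
          by_cases h2 : n + 1 = 1 + l.length
          · rw [if_neg h1, if_pos h2, List.getD_eq_default _ _ (by omega)]
          rw [if_neg h1, if_neg h2, g6]
          by_cases h3 : n < l.length
          · rw [if_pos (by omega), Nat.add_sub_cancel]
          · rw [if_neg (by omega), List.getD_eq_default _ _ (by omega)]
            -- Cells behind the two cleared ones lie behind the original input, as `k ≤ 3`.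
            obtain ⟨j, hj⟩ : ∃ j, n + 1 = k + j := ⟨n + 1 - k, by omega⟩
            rw [hj, h.cells, List.getD_eq_default _ _ (by omega)]
      · simp [Memory.init, Instr.apply, Function.update_apply, h0, g5 i h0, h.arr_zero i h0]
  all_goals simp [Instr.apply, Function.update_apply, e1, e2, e3, h.beta]

/-- Read a natural number `K` from cell `0` of array `0` into the index register `N`. -/
def readLength (N : ℕ) : Program :=
  .seq (.block (.idxZero N) [.load (N + 5) 0 N, .ofIdx (N + 7) N])
    (.loop (.regLt (N + 7) (N + 5)) (.block (.idxSucc N) [.ofIdx (N + 7) N]))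

theorem runs_readLength (N K : ℕ) (μ : Memory) (hK : μ.arr 0 0 = K) :
    ∃ μ', (readLength N).Runs μ (3 * K + 4) μ' ∧
      (∀ i, i ≠ N + 5 → i ≠ N + 7 → μ'.reg i = μ.reg i) ∧ μ'.idx N = K ∧
      (∀ i, i ≠ N → μ'.idx i = μ.idx i) ∧ μ'.arr = μ.arr := by
  -- `j` is the number of iterations that remain.
  have hloop : ∀ (j : ℕ) (ν : Memory), ν.reg (N + 5) = K → ν.reg (N + 7) = ν.idx N →
      ν.idx N + j = K → ∃ ν', (loop (.regLt (N + 7) (N + 5))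
        (.block (.idxSucc N) [.ofIdx (N + 7) N])).Runs ν (3 * j + 1) ν' ∧
      (∀ i, i ≠ N + 7 → ν'.reg i = ν.reg i) ∧ ν'.idx N = K ∧
      (∀ i, i ≠ N → ν'.idx i = ν.idx i) ∧ ν'.arr = ν.arr := by
    intro j
    induction j with
    | zero =>
      intro ν h5 h7 hj
      refine ⟨ν, .loop_done ?_, fun _ _ => rfl, hj, fun _ _ => rfl, rfl⟩
      simp only [Test.Holds, h5, h7, not_lt, Nat.cast_le]
      omega
    | succ j ih =>
      intro ν h5 h7 hj
      obtain ⟨ν', hr, g1, g2, g3, g4⟩ := ih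
        (Instr.apply (.ofIdx (N + 7) N) (Instr.apply (.idxSucc N) ν))
        (by simp [Instr.apply, h5])
        (by simp [Instr.apply])
        (by simp [Instr.apply]; omega)
      refine ⟨ν', ?_, fun i hi => ?_, g2, fun i hi => ?_, ?_⟩
      · have := Runs.loop_step (c := .regLt (N + 7) (N + 5))
          (by simp only [Test.Holds, h5, h7, Nat.cast_lt]; omega)
          (runs_block (.idxSucc N) [.ofIdx (N + 7) N] ν) hr
        exact this.cast (by simp only [List.length_cons, List.length_nil]; ring)
      · rw [g1 i hi]; simp [Instr.apply, hi]
      · rw [g3 i hi]; simp [Instr.apply, hi]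
      · rw [g4]; simp [Instr.apply]
  obtain ⟨μ', hr, g1, g2, g3, g4⟩ := hloop K
    ([Instr.load (N + 5) 0 N, .ofIdx (N + 7) N].foldl (fun μ j => j.apply μ)
      (Instr.apply (.idxZero N) μ))
    (by simp [Instr.apply, hK])
    (by simp [Instr.apply])
    (by simp [Instr.apply])
  refine ⟨μ', ?_, fun i h5 h7 => ?_, g2, fun i hi => ?_, ?_⟩
  · have := Runs.seq (runs_block (.idxZero N) [.load (N + 5) 0 N, .ofIdx (N + 7) N] μ) hr
    exact this.cast (by simp only [List.length_cons, List.length_nil]; ring)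
  · rw [g1 i h7]; simp [Instr.apply, h5, h7]
  · rw [g3 i hi]; simp [Instr.apply, hi]
  · rw [g4]; simp [Instr.apply]

/-- Compute the cut-off, run the emulation `E`, and read the length of the presentation of the
source system. -/
def emulate (E : Program) (C : ℝ) (N : ℕ) : Program :=
  .seq (prepare C N) (.seq E (readLength N))

theorem runs_emulate {E : Program} {N : ℕ} (hN : 0 < N) (hE : E.bound ≤ N) {C : ℝ} {k : ℕ}
    {l : List ℝ} {ε β : ℝ} {μ : Memory} (h : Ready N k l ε β μ) {W : ℝ}
    (hW : (l.map fun x => x + 1).sum = W) {t : ℕ} {l₁ l₂ : List ℝ}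
    (hc : E.ComputesWithin ((W + (C * Real.exp W + 1 + 2 / ε) / β) :: l) t
      ((l₁.length : ℝ) :: (l₁ ++ l₂))) :
    ∃ t' μ', t' ≤ 7 * l.length + t + 3 * l₁.length + 21 ∧ (emulate E C N).Runs μ t' μ' ∧
      μ'.idx N = l₁.length ∧ (∀ n < (l₁ ++ l₂).length, μ'.arr 0 (n + 1) = (l₁ ++ l₂).getD n 0) ∧
      μ'.reg (N + 1) = μ.reg (N + 1) ∧ μ'.reg (N + 2) = β ∧
      μ'.reg (N + 3) = μ.reg (N + 3) := by
  obtain ⟨μ₁, r₁, a₁, b₁, b₂, b₃⟩ := runs_prepare (C := C) hN h hW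
  obtain ⟨t', ν, ht, hr, -, ho⟩ := hc
  obtain ⟨μ₂, r₂, a₂, a₃⟩ := hr.frame hE a₁
  have harr : ν.arr 0 = μ₂.arr 0 := (a₂ 0 hN).2.2
  obtain ⟨μ₃, r₃, c₁, c₂, -, c₃⟩ := runs_readLength N l₁.length μ₂ (by
    rw [← harr, ho 0 (by simp)]; rfl)
  refine ⟨_, μ₃, ?_, .seq r₁ (.seq r₂ r₃), c₂, fun n hn => ?_, ?_, ?_, ?_⟩
  · omega
  · rw [c₃, ← harr, ho (n + 1) (by simpa using hn), List.getElem_cons_succ,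
      List.getD_eq_getElem _ _ hn]
  · rw [c₁ _ (by omega) (by omega), ← (a₃ (N + 1) (by simp)).1, b₁]
  · rw [c₁ _ (by omega) (by omega), ← (a₃ (N + 2) (by simp)).1, b₂, h.beta]
  · rw [c₁ _ (by omega) (by omega), ← (a₃ (N + 3) (by simp)).1, b₃]

/-- On input `ε, β, T`, output `β` and the source system of the emulation. -/
def instanceMap (E : Program) (C : ℝ) (N : ℕ) : Program :=
  .seq (.block (.load N 0 N) [.idxSucc N, .load (N + 2) 0 N, .idxCopy (N + 1) N,
    .idxSucc (N + 1), .const (N + 6) 1])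
  (.seq (emulate E C N)
    (.block (.idxSucc N) [.idxCopy 0 N, .idxZero N, .store 0 N (N + 2)]))

theorem computesWithin_instanceMap {E : Program} {N : ℕ} (hN : 0 < N) (hE : E.bound ≤ N) {C : ℝ}
    {l : List ℝ} {ε β W : ℝ} (hW : (l.map fun x => x + 1).sum = W) {t : ℕ} {l₁ l₂ : List ℝ}
    (hc : E.ComputesWithin ((W + (C * Real.exp W + 1 + 2 / ε) / β) :: l) t
      ((l₁.length : ℝ) :: (l₁ ++ l₂))) :
    (instanceMap E C N).ComputesWithin (ε :: β :: l) (7 * l.length + t + 3 * l₁.length + 31)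
      (β :: l₁) := by
  have hready : Ready N 2 l ε β ([Instr.idxSucc N, .load (N + 2) 0 N, .idxCopy (N + 1) N,
      .idxSucc (N + 1), .const (N + 6) 1].foldl (fun μ j => j.apply μ)
      (Instr.apply (.load N 0 N) (Memory.init (ε :: β :: l)))) := by
    have hne : ∀ i < N, ∀ j, ¬ i = N + j := fun i hi j => by omega
    exact {
      two_le := le_rfl
      le_three := by omega
      dest := by simp [Instr.apply, Memory.init, hN.ne']
      source := by simp [Instr.apply, Memory.init, hN.ne']
      length := by simp [Instr.apply, Memory.init, hN.ne]; omega
      cells := fun n => by simp [Instr.apply, Memory.init, add_comm 2 n]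
      eps := by simp [Instr.apply, Memory.init, hN.ne']
      beta := by simp [Instr.apply, Memory.init, hN.ne']
      weight := by simp [Instr.apply, Memory.init]
      one := by simp [Instr.apply]
      reg_zero := fun i hi => by
        simp [Instr.apply, Memory.init, hne i hi, hi.ne]
      idx_zero := fun i hi h0 => by
        simp [Instr.apply, Memory.init, hne i hi, hi.ne, h0]
      arr_zero := fun i h0 => by simp [Instr.apply, Memory.init, h0] }
  obtain ⟨t', μ, ht, hr, h0, harr, -, h2, -⟩ := runs_emulate hN hE hready hW hc
  refine ⟨_, _, ?_, .seq (runs_block _ _ _) (.seq hr (runs_block _ _ _)), ?_, fun n hn => ?_⟩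
  · simp only [List.length_cons, List.length_nil]
    omega
  · simp [Instr.apply, h0, hN.ne]
  · rcases n with _ | n
    · simp [Instr.apply, h2]
    · have hn' : n < l₁.length := by simpa using hn
      have := harr n (by simp; omega)
      simp [Instr.apply, this, hn', List.getElem?_append_left]

/-- On input `ε, z, β, T`, output `z / (e^{-βΓ} m d)`, where `m` is replaced by `1` if `T` has no
spins. -/
def valueMap (E : Program) (C : ℝ) (N : ℕ) : Program :=
  .seq (.block (.load N 0 N) [.idxSucc N, .load (N + 1) 0 N, .idxCopy (N + 1) N,
    .idxSucc (N + 1), .load (N + 2) 0 (N + 1), .idxSucc (N + 1), .idxCopy (N + 2) (N + 1),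
    .idxSucc (N + 2), .load (N + 3) 0 (N + 2), .const (N + 6) 1])
  (.seq (emulate E C N)
  (.seq (.block (.idxSucc N) [.idxSucc N, .load (N + 5) 0 N, .idxSucc N, .load (N + 7) 0 N,
    .idxSucc N, .idxSucc N, .load (N + 8) 0 N, .const (N + 9) 0])
  (.seq (.ite (.regLt (N + 9) (N + 3)) (.instr (.const (N + 9) 0)) (.instr (.const (N + 8) 1)))
    (.block (.sub (N + 9) (N + 9) (N + 2)) [.mul (N + 9) (N + 9) (N + 5), .exp (N + 9) (N + 9),
      .mul (N + 9) (N + 9) (N + 8), .mul (N + 9) (N + 9) (N + 7), .div (N + 1) (N + 1) (N + 9),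
      .idxZero N, .idxCopy 0 N, .store 0 N (N + 1), .idxSucc 0]))))

theorem computesWithin_valueMap {E : Program} {N : ℕ} (hN : 0 < N) (hE : E.bound ≤ N) {C : ℝ}
    {l : List ℝ} {ε z β W : ℝ} (hW : (l.map fun x => x + 1).sum = W) {t : ℕ}
    {l₁ l₂ : List ℝ} (hl₂ : 4 < l₂.length)
    (hc : E.ComputesWithin ((W + (C * Real.exp W + 1 + 2 / ε) / β) :: l) t
      ((l₁.length : ℝ) :: (l₁ ++ l₂))) :
    (valueMap E C N).ComputesWithin (ε :: z :: β :: l) (7 * l.length + t + 3 * l₁.length + 53)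
      [z / (Real.exp (-β * l₂.getD 1 0) * (if 0 < l.getD 1 0 then l₂.getD 4 0 else 1) *
        l₂.getD 2 0)] := by
  have hready : Ready N 3 l ε β ([Instr.idxSucc N, .load (N + 1) 0 N, .idxCopy (N + 1) N,
      .idxSucc (N + 1), .load (N + 2) 0 (N + 1), .idxSucc (N + 1), .idxCopy (N + 2) (N + 1),
      .idxSucc (N + 2), .load (N + 3) 0 (N + 2), .const (N + 6) 1].foldl
      (fun μ j => j.apply μ) (Instr.apply (.load N 0 N) (Memory.init (ε :: z :: β :: l)))) := by
    have hne : ∀ i < N, ∀ j, ¬ i = N + j := fun i hi j => by omega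
    exact {
      two_le := by omega
      le_three := le_rfl
      dest := by simp [Instr.apply, Memory.init, hN.ne']
      source := by simp [Instr.apply, Memory.init, hN.ne']
      length := by simp [Instr.apply, Memory.init, hN.ne]; omega
      cells := fun n => by simp [Instr.apply, Memory.init, add_comm 3 n]
      eps := by simp [Instr.apply, Memory.init, hN.ne']
      beta := by simp [Instr.apply, Memory.init, hN.ne']
      weight := by simp [Instr.apply, Memory.init]
      one := by simp [Instr.apply]
      reg_zero := fun i hi => by
        simp [Instr.apply, Memory.init, hne i hi, hi.ne]
      idx_zero := fun i hi h0 => by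
        simp [Instr.apply, Memory.init, hne i hi, hi.ne, h0]
      arr_zero := fun i h0 => by simp [Instr.apply, Memory.init, h0] }
  obtain ⟨t', μ, ht, hr, h0, harr, h1, h2, h3⟩ := runs_emulate hN hE hready hW hc
  replace h1 : μ.reg (N + 1) = z := by
    rw [h1]; simp [Instr.apply, Memory.init, hN.ne']
  replace h3 : μ.reg (N + 3) = l.getD 1 0 := by
    rw [h3]; simp [Instr.apply, Memory.init, hN.ne']
  -- The output of the emulation is `l₁.length`, `l₁`, `l₂`, so `l₂` starts in cell `l₁.length + 1`.
  have hentry : ∀ j < 5, μ.arr 0 (l₁.length + (j + 1)) = l₂.getD j 0 := fun j hj => by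
    rw [← add_assoc, harr _ (by rw [List.length_append]; omega),
      List.getD_append_right _ _ _ _ (by omega), Nat.add_sub_cancel_left]
  have hs := hentry 1 (by omega)
  have hd := hentry 2 (by omega)
  have hm := hentry 4 (by omega)
  set code : List Instr := [.idxSucc N, .load (N + 5) 0 N, .idxSucc N, .load (N + 7) 0 N,
    .idxSucc N, .idxSucc N, .load (N + 8) 0 N, .const (N + 9) 0] with hcode
  have r₁ := runs_block (.idxSucc N) code μ
  set ν := code.foldl (fun μ j => j.apply μ) (Instr.apply (.idxSucc N) μ) with hν
  have k1 : ν.reg (N + 1) = z := by simp [hν, hcode, Instr.apply, h1]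
  have k2 : ν.reg (N + 2) = β := by simp [hν, hcode, Instr.apply, h2]
  have k3 : ν.reg (N + 3) = l.getD 1 0 := by rw [← h3]; simp [hν, hcode, Instr.apply]
  have k5 : ν.reg (N + 5) = l₂.getD 1 0 := by rw [← hs]; simp [hν, hcode, Instr.apply, h0]
  have k7 : ν.reg (N + 7) = l₂.getD 2 0 := by rw [← hd]; simp [hν, hcode, Instr.apply, h0]
  have k8 : ν.reg (N + 8) = l₂.getD 4 0 := by rw [← hm]; simp [hν, hcode, Instr.apply, h0]
  have k9 : ν.reg (N + 9) = 0 := by simp [hν, hcode, Instr.apply]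
  clear_value ν
  have hite : ∃ ρ, (ite (.regLt (N + 9) (N + 3)) (.instr (.const (N + 9) 0))
      (.instr (.const (N + 8) 1))).Runs ν 2 ρ ∧ ρ.reg (N + 1) = z ∧ ρ.reg (N + 2) = β ∧
      ρ.reg (N + 5) = l₂.getD 1 0 ∧ ρ.reg (N + 7) = l₂.getD 2 0 ∧
      ρ.reg (N + 8) = (if 0 < l.getD 1 0 then l₂.getD 4 0 else 1) ∧ ρ.reg (N + 9) = 0 := by
    by_cases hV : 0 < l.getD 1 0
    · refine ⟨_, .ite_pos (by simpa only [Test.Holds, k9, k3] using hV) (.instr _ _), ?_⟩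
      rw [if_pos hV, ← k1, ← k2, ← k5, ← k7, ← k8]
      simp [Instr.apply]
    · refine ⟨_, .ite_neg (by simpa only [Test.Holds, k9, k3] using hV) (.instr _ _), ?_⟩
      rw [if_neg hV, ← k1, ← k2, ← k5, ← k7]
      simp [Instr.apply, k9]
  obtain ⟨ρ, r₂, m1, m2, m5, m7, m8, m9⟩ := hite
  refine ⟨_, _, ?_, .seq (runs_block _ _ _) (.seq hr (.seq r₁ (.seq r₂ (runs_block _ _ _)))), ?_,
    fun n hn => ?_⟩
  · simp only [hcode, List.length_cons, List.length_nil]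
    omega
  · simp [Instr.apply]
  · obtain rfl : n = 0 := by simpa using hn
    simp only [List.foldl_cons, List.foldl_nil, List.getElem_cons_zero]
    rw [← m8, ← m1, ← m2, ← m5, ← m7]
    simp [Instr.apply, m9, hN.ne']

end Program

/-! ### The reduction -/

theorem Program.ComputesWithin.mono {P : Program} {l l' : List ℝ} {t t' : ℕ}
    (h : P.ComputesWithin l t l') (ht : t ≤ t') : P.ComputesWithin l t' l' := by
  obtain ⟨s, μ, hs, hr⟩ := h
  exact ⟨s, μ, hs.trans ht, hr⟩

theorem eval_le_eval_of_le (p : Polynomial ℕ) {m n : ℕ} (h : m ≤ n) : p.eval m ≤ p.eval n := by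
  rw [Polynomial.eval_eq_sum_range, Polynomial.eval_eq_sum_range]
  gcongr

theorem PresentsSystem.getD_one {q : ℕ} {S : SpinSystem q} {l : List ℝ}
    (h : PresentsSystem S l) : l.getD 1 0 = S.graph.V.card := by
  obtain ⟨LV, LE, Le, Lc, hV, -, -, -, rfl⟩ := h
  simp [hV.length_eq]

/-- Where shift, degeneracy and number of encodings are found in a presentation. -/
theorem PresentsSimulation.entries {q q' : ℕ} {S : SpinSystem q} {T : SpinSystem q'}
    {f : Simulation S T} {l : List ℝ} (h : PresentsSimulation f l) :
    4 < l.length ∧ l.getD 1 0 = f.shift ∧ l.getD 2 0 = f.data.degeneracy ∧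
      l.getD 4 0 = f.data.coding.number := by
  obtain ⟨LT, Lx, -, -, rfl⟩ := h
  refine ⟨?_, rfl, rfl, rfl⟩
  simp only [List.length_append, List.length_cons]
  omega

/-- Replace the input `ε` by `ε / 2`. -/
def Program.halve : Program :=
  .block (.load 0 0 1) [.const 1 2, .div 0 0 1, .store 0 1 0]

theorem Program.computesWithin_halve (ε : ℝ) : Program.halve.ComputesWithin [ε] 4 [ε / 2] := by
  refine ⟨_, _, le_rfl, runs_block _ _ _, by simp [Instr.apply, Memory.init], fun n hn => ?_⟩
  obtain rfl : n = 0 := by simpa using hn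
  simp [Instr.apply, Memory.init]

namespace Emulation

variable {q q' : ℕ} {M : SpinModel q} {M' : SpinModel q'}

/-- `p` bounds the running time of the emulation. -/
def HasRuntime (Emu : Emulation M M') (p : Polynomial ℕ) : Prop :=
  ∀ (T : M'.systems) (δ : ℝ≥0) (l : List ℝ), PresentsSystem T.1 l →
    ∃ l₁ l₂, PresentsSystem (Emu.source T δ) l₁ ∧ PresentsSimulation (Emu.sim T δ) l₂ ∧
      Emu.program.ComputesWithin ((δ : ℝ) :: l) (p.eval T.1.size)
        ((l₁.length : ℝ) :: (l₁ ++ l₂))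

theorem exists_hasRuntime (Emu : Emulation M M') : ∃ p, Emu.HasRuntime p := by
  obtain ⟨p, hp⟩ := Emu.efficient
  refine ⟨p, fun T δ l hl => ?_⟩
  obtain ⟨_, ⟨l₁, l₂, h₁, h₂, rfl⟩, hc⟩ := hp (T, δ) ((δ : ℝ) :: l) ⟨l, hl, rfl⟩
  exact ⟨l₁, l₂, h₁, h₂, hc⟩

theorem length_le_of_computesWithin {P : Program} {δ : ℝ} {l l₁ l₂ : List ℝ} {t : ℕ}
    (h : P.ComputesWithin (δ :: l) t ((l₁.length : ℝ) :: (l₁ ++ l₂))) :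
    l₁.length ≤ l.length + t := by
  have := h.length_le
  simp only [List.length_cons, List.length_append] at this
  omega

/-- The source system is an output of a polynomial-time program, hence `|V_S| log q`, which is at
most `q |V_S|`, is bounded by a constant times the exponential of the weight of `T`. -/
theorem exists_card_bound (Emu : Emulation M M') :
    ∃ C : ℝ, 0 ≤ C ∧ ∀ T δ, ((q * (Emu.source T δ).graph.V.card : ℕ) : ℝ) ≤
      C * Real.exp T.1.weight := by
  obtain ⟨p, hp⟩ := Emu.exists_hasRuntime
  obtain ⟨C, hC, h⟩ := exists_polynomial_le_exp (Polynomial.C q * (Polynomial.X + p))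
  refine ⟨C, hC, fun T δ => ?_⟩
  obtain ⟨l, hl⟩ := T.1.exists_presentsSystem
  obtain ⟨l₁, l₂, h₁, -, hc⟩ := hp T δ l hl
  have hV : (Emu.source T δ).graph.V.card ≤ l.length + p.eval l.length :=
    calc _ ≤ l₁.length := h₁.card_V_le_length
      _ ≤ l.length + p.eval T.1.size := length_le_of_computesWithin hc
      _ ≤ _ := by gcongr; exact eval_le_eval_of_le p hl.size_le_length
  calc ((q * (Emu.source T δ).graph.V.card : ℕ) : ℝ)
      ≤ (((Polynomial.C q * (Polynomial.X + p)).eval l.length : ℕ) : ℝ) := by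
        simp only [Polynomial.eval_mul, Polynomial.eval_C, Polynomial.eval_add, Polynomial.eval_X]
        exact_mod_cast Nat.mul_le_mul_left q hV
    _ ≤ C * Real.exp l.length := h l.length
    _ ≤ _ := by
        gcongr
        exact hl.length_le_weight

/-- The cut-off at which the emulation is run. -/
noncomputable def cutoffFor {C : ℝ} (hC : 0 ≤ C) (T : M'.systems) (β ε : PosReal) : ℝ≥0 :=
  ⟨cutoffValue C T.1 β ε,
    T.1.weight_nonneg.trans (weight_lt_cutoffValue hC T.1 β.2 ε.2).le⟩

/-- A polynomial bound for the running times of the reduction, given one for the emulation. -/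
noncomputable def reductionTime (p : Polynomial ℕ) : Polynomial ℕ :=
  10 * (Polynomial.X ^ 2 + 5 * Polynomial.X + 3) + 4 * p + 53

theorem le_eval_reductionTime (p : Polynomial ℕ) {T : SpinSystem q'} {l : List ℝ}
    (hl : PresentsSystem T l) {k : ℕ} (hk : k ≤ l.length + p.eval T.size) :
    7 * l.length + p.eval T.size + 3 * k + 53 ≤ (reductionTime p).eval (T.size + 1) := by
  refine le_trans ?_ (eval_le_eval_of_le (reductionTime p) (Nat.le_succ T.size))
  have := hl.length_le
  simp only [reductionTime, Polynomial.eval_add, Polynomial.eval_mul, Polynomial.eval_pow,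
    Polynomial.eval_X, Polynomial.eval_ofNat]
  omega

/-- The PTAS reduction induced by an emulation. -/
noncomputable def ptasReduction (Emu : Emulation M M') {C : ℝ} (hC : 0 ≤ C)
    (hV : ∀ T δ, ((q * (Emu.source T δ).graph.V.card : ℕ) : ℝ) ≤ C * Real.exp T.1.weight) :
    PTASReduction (partitionProblem M') (partitionProblem M) where
  f a ε := (⟨Emu.source a.1 (cutoffFor hC a.1 a.2 ε), Emu.source_mem _ _⟩, a.2)
  g a z ε := z / (Real.exp (-(a.2 : ℝ) * (Emu.sim a.1 (cutoffFor hC a.1 a.2 ε)).shift) *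
    (Emu.sim a.1 (cutoffFor hC a.1 a.2 ε)).multiplicity *
    (Emu.sim a.1 (cutoffFor hC a.1 a.2 ε)).data.degeneracy)
  α ε := ⟨ε / 2, half_pos ε.2⟩
  f_polytime := by
    obtain ⟨p, hp⟩ := Emu.exists_hasRuntime
    refine ⟨.instanceMap Emu.program C (Emu.program.bound + 1), reductionTime p, ?_⟩
    rintro ⟨⟨T, β⟩, ε⟩ _ ⟨_, ⟨l, hl, rfl⟩, rfl⟩
    obtain ⟨l₁, l₂, h₁, -, hc⟩ := hp T (cutoffFor hC T β ε) l hl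
    refine ⟨_, ⟨l₁, h₁, rfl⟩, ?_⟩
    refine (Program.computesWithin_instanceMap (Nat.succ_pos _) (Nat.le_succ _) (hl.sum_map _)
      hc).mono (le_trans ?_ (le_eval_reductionTime p hl (length_le_of_computesWithin hc)))
    exact Nat.add_le_add_left (by norm_num : 31 ≤ 53) _
  g_polytime := by
    obtain ⟨p, hp⟩ := Emu.exists_hasRuntime
    refine ⟨.valueMap Emu.program C (Emu.program.bound + 1), reductionTime p, ?_⟩
    rintro ⟨⟨T, β⟩, z, ε⟩ _ ⟨_, ⟨l, hl, rfl⟩, rfl⟩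
    obtain ⟨l₁, l₂, -, h₂, hc⟩ := hp T (cutoffFor hC T β ε) l hl
    obtain ⟨hlen, hs, hd, hm⟩ := h₂.entries
    refine ⟨_, rfl, ?_⟩
    have h := (Program.computesWithin_valueMap (z := z) (Nat.succ_pos _) (Nat.le_succ _)
      (hl.sum_map _) hlen hc).mono
      (le_eval_reductionTime p hl (length_le_of_computesWithin hc))
    have hmul : (if 0 < l.getD 1 0 then l₂.getD 4 0 else 1) =
        ((Emu.sim T (cutoffFor hC T β ε)).multiplicity : ℝ) := by
      rw [hl.getD_one, hm, Simulation.multiplicity]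
      simp only [Nat.cast_pos, Finset.card_pos]
      split_ifs <;> simp
    rw [hmul, hs, hd] at h
    exact h
  α_polytime := ⟨.halve, 4, fun ε l hl => ⟨_, rfl, by
    rw [hl]
    exact (Program.computesWithin_halve ε).mono (by simp)⟩⟩
  correct := by
    rintro ⟨T, β⟩ ε z hz
    have hcut := Emu.cutoff_eq T (cutoffFor hC T β ε)
    refine (Emu.sim T (cutoffFor hC T β ε)).isApprox_rescale β.2 ε.2 (fun t => ?_) ?_ hz
    · rw [hcut]
      exact (T.1.hamiltonian_le_weight t).trans_lt (weight_lt_cutoffValue hC T.1 β.2 ε.2)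
    · rw [hcut]
      exact error_lt T.1 β.2 ε.2 (hV T _)

end Emulation

end SpinEmulation

theorem mainTheorem6 {q q' : ℕ} (M : SpinEmulation.SpinModel q) (M' : SpinEmulation.SpinModel q')
    (Emu : SpinEmulation.Emulation M M') :
    ∃ (R : SpinEmulation.PTASReduction (SpinEmulation.partitionProblem M')
        (SpinEmulation.partitionProblem M))
      (δ : M'.systems → SpinEmulation.PosReal → SpinEmulation.PosReal → ℝ≥0),
      (∀ ε, (R.α ε : ℝ) = (ε : ℝ) / 2) ∧
      ∀ (T : M'.systems) (β ε : SpinEmulation.PosReal),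
        -- the reduction maps `T` to its source system with cut-off `δ`, at the same temperature
        R.f (T, β) ε = (⟨Emu.source T (δ T β ε), Emu.source_mem T (δ T β ε)⟩, β) ∧
        -- the cut-off is above the spectrum of `T`
        (∀ t : T.1.Config, T.1.hamiltonian t < δ T β ε) ∧
        -- relative to `Z_T(β)`, the exponentially small error term is below `ε / 2`
        (1 + (ε : ℝ) / 2) *
            ((q : ℝ) ^ (Emu.source T (δ T β ε)).graph.V.card /
              (((Emu.sim T (δ T β ε)).data.coding.number : ℝ) *
                (Emu.sim T (δ T β ε)).data.degeneracy)) *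
            Real.exp (-(β : ℝ) * (δ T β ε : ℝ)) <
          (ε : ℝ) / 2 * T.1.partitionFunction β ∧
        -- approximations are transformed by rescaling
        (T.1.graph.V.Nonempty → ∀ z : ℝ, R.g (T, β) z ε =
          z / (Real.exp (-(β : ℝ) * (Emu.sim T (δ T β ε)).shift) *
            ((Emu.sim T (δ T β ε)).data.coding.number : ℝ) *
            (Emu.sim T (δ T β ε)).data.degeneracy)) := by
  obtain ⟨C, hC, hV⟩ := Emu.exists_card_bound
  refine ⟨Emu.ptasReduction hC hV, SpinEmulation.Emulation.cutoffFor hC, fun _ => rfl,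
    fun T β ε => ⟨rfl, fun t => ?_, ?_, fun hT z => ?_⟩⟩
  · exact (T.1.hamiltonian_le_weight t).trans_lt
      (SpinEmulation.weight_lt_cutoffValue hC T.1 β.2 ε.2)
  -- `error_lt` bounds the error term even without the denominator `m d ≥ 1`.
  · set f := Emu.sim T (SpinEmulation.Emulation.cutoffFor hC T β ε)
    have hε := ε.2
    have hmd : (1 : ℝ) ≤ (f.data.coding.number : ℝ) * f.data.degeneracy := by
      exact_mod_cast Nat.mul_pos f.number_pos f.degeneracy_pos
    refine lt_of_le_of_lt ?_ (SpinEmulation.error_lt T.1 β.2 hε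
      (hV T (SpinEmulation.Emulation.cutoffFor hC T β ε)))
    rw [mul_assoc]
    exact mul_le_mul_of_nonneg_left (mul_le_mul_of_nonneg_right
      (div_le_self (by positivity) hmd) (Real.exp_pos _).le) (by positivity)
  · simp only [SpinEmulation.Emulation.ptasReduction, SpinEmulation.Simulation.multiplicity,
      if_pos hT]
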